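/- Fix a countably infinite set $\mathsf{Var}$ of program variables and let $\mathbb{Q}^+$ be the set of non-negative rationals. Arithmetical expressions $e$ are built from variables and constants in $\mathbb{Q}^+$ by $+,-,\cdot$ and are evaluated in $\mathbb{Q}$; Boolean expressions $b$ are built from comparisons $e=e'$, $e<e'$ by $\neg,\wedge,\vee$. Probabilistic programs are given by $$P ::= v:=e \;\mid\; P;P \;\mid\; \{P\}\,[p]\,\{P\} \;\mid\; \mathtt{WHILE}\,(b)\,\{P\}, \qquad v\in\mathsf{Var},\ p\in[0,1]\cap\mathbb{Q}.$$ A valuation is a function $\eta:\mathsf{Var}\to\mathbb{Q}^+$ with $\eta(v)=0$ for all but finitely many $v$. A state is $\langle C,\eta,a,\theta\rangle$, where $C$ is a program, the terminal symbol $\downarrow$, or a program with $\downarrow$ in place of its leftmost component, $a\in[0,1]\cap\mathbb{Q}$, and $\theta\in\{L,R\}^*$. The step relation $\vdash$ is the least relation such that - $\langle v:=e,\eta,a,\theta\rangle\vdash\langle\downarrow,\eta[v\mapsto\max\{[\![e]\!]_\eta,0\}],a,\theta\rangle$; - if $\langle C,\eta,a,\theta\rangle\vdash\langle C',\eta',a',\theta'\rangle$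 then $\langle C;P_2,\eta,a,\theta\rangle\vdash\langle C';P_2,\eta',a',\theta'\rangle$; - $\langle\downarrow;P_2,\eta,a,\theta\rangle\vdash\langle P_2,\eta,a,\theta\rangle$; - $\langle\{P_1\}[p]\{P_2\},\eta,a,\theta\rangle\vdash\langle P_1,\eta,a\cdot p,\theta L\rangle$ and $\langle\{P_1\}[p]\{P_2\},\eta,a,\theta\rangle\vdash\langle P_2,\eta,a\cdot(1-p),\theta R\rangle$; - $\langle\mathtt{WHILE}(b)\{P\},\eta,a,\theta\rangle$ steps to $\langle P;\mathtt{WHILE}(b)\{P\},\eta,a,\theta\rangle$ if $[\![b]\!]_\eta$ is true and to $\langle\downarrow,\eta,a,\theta\rangle$ if it is false. For $k\in\mathbb{N}$, a state $\sigma$ and a word $w\in\{L,R\}^*$ let $T_k(\sigma,w)$ be the unique state reached from $\sigma$ by exactly $k$ steps in which the letters appended to $\theta$ are exactly those of $w$, in order, if there is such a state, and $T_k(\sigma,w)=\bot$ otherwise. Put $\wp(\langle\downarrow,\eta,a,\theta\rangle,v)=\eta(v)\cdot a$ and $\wp(\sigma,v)=0$ for $\sigma=\bot$ and for every non-terminal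 state $\sigma$. The expected outcome of $v$ after executing $P$ on $\eta$ is $$E_{P,\eta}(v)=\sum_{k=0}^{\infty}\ \sum_{w\in\{L,R\}^{\le k}}\wp\big(T_k(\langle P,\eta,1,\varepsilon\rangle,w),v\big)\in[0,\infty].$$ A set $A$ of (effectively coded) finite objects is in $\Sigma_1^0$ if there is a decidable relation $R$ with $x\in A\iff\exists y\in\mathbb{N}\;(x,y)\in R$. It is $\Sigma_1^0$-hard if every set $C$ in $\Sigma_1^0$ is many-one reducible to it, that is, there is a total computable $f$ with $x\in C\iff f(x)\in A$ for all $x$. It is $\Sigma_1^0$-complete if it is in $\Sigma_1^0$ and $\Sigma_1^0$-hard. **Theorem.** The set $$\mathcal{LEXP}=\{(P,\eta,v,q)\ :\ P \text{ a probabilistic program},\ \eta \text{ a valuation},\ v\in\mathsf{Var},\ q\in\mathbb{Q}^+,\ q<E_{P,\eta}(v)\}$$ is $\Sigma_1^0$-complete. -/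

import Mathlib

open scoped NNRat NNReal ENNReal

noncomputable section

namespace PGCL

/-! ## Syntax -/

/-- Program variables: a fixed countably infinite set. -/
abbrev Var : Type := ℕ

/-- Rational probabilities, `[0, 1] ∩ ℚ`. -/
abbrev Prob : Type := {p : ℚ≥0 // p ≤ 1}

namespace Prob

/-- Product of two probabilities. -/
def mul (a p : Prob) : Prob := ⟨a.1 * p.1, mul_le_one' a.2 p.2⟩

/-- The complementary probability `1 - p`. -/
def compl (p : Prob) : Prob := ⟨1 - p.1, tsub_le_self⟩

/-- The probability one. -/
def one : Prob := ⟨1, le_refl 1⟩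

end Prob

/-- Arithmetical expressions over `Var`. -/
inductive AExpr : Type
  | const (c : ℚ≥0)
  | var (v : Var)
  | add (e₁ e₂ : AExpr)
  | sub (e₁ e₂ : AExpr)
  | mul (e₁ e₂ : AExpr)

/-- Boolean expressions over arithmetical expressions. -/
inductive BExpr : Type
  | eq (e₁ e₂ : AExpr)
  | lt (e₁ e₂ : AExpr)
  | not (b : BExpr)
  | and (b₁ b₂ : BExpr)
  | or (b₁ b₂ : BExpr)

/-- Probabilistic programs:
`v := e`, `P₁; P₂`, `{P₁} [p] {P₂}` and `WHILE (b) {P}`. -/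
inductive Prog : Type
  | assign (v : Var) (e : AExpr)
  | seq (P₁ P₂ : Prog)
  | choice (p : Prob) (P₁ P₂ : Prog)
  | loop (b : BExpr) (P : Prog)

/-! ## Operational semantics -/

/-- Variable valuations `Var → ℚ≥0`, zero at all but finitely many variables. -/
abbrev Valuation : Type := Var →₀ ℚ≥0

/-- Value of an arithmetical expression, computed in `ℚ`. -/
def AExpr.eval (η : Valuation) : AExpr → ℚ
  | const c => (c : ℚ)
  | var v => (η v : ℚ)
  | add e₁ e₂ => e₁.eval η + e₂.eval η
  | sub e₁ e₂ => e₁.eval η - e₂.eval η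
  | mul e₁ e₂ => e₁.eval η * e₂.eval η

/-- Value of a Boolean expression. -/
def BExpr.eval (η : Valuation) : BExpr → Bool
  | eq e₁ e₂ => decide (e₁.eval η = e₂.eval η)
  | lt e₁ e₂ => decide (e₁.eval η < e₂.eval η)
  | not b => !(b.eval η)
  | and b₁ b₂ => b₁.eval η && b₂.eval η
  | or b₁ b₂ => b₁.eval η || b₂.eval η

/-- Outcomes of probabilistic choices: left or right. -/
inductive Dir : Type
  | L
  | R
  deriving DecidableEq

instance instFintypeDir : Fintype Dir := ⟨{Dir.L, Dir.R}, by intro d; cases d <;> simp⟩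

/-- What remains to be executed: the terminal symbol `↓`, or a program, where in addition the
left end of a sequential composition may already be `↓` (as in `↓; P₂`). -/
inductive Ctrl : Type
  | halt
  | assign (v : Var) (e : AExpr)
  | seq (c : Ctrl) (P₂ : Prog)
  | choice (p : Prob) (P₁ P₂ : Prog)
  | loop (b : BExpr) (P : Prog)

/-- A program, seen as something that remains to be executed. -/
def Prog.toCtrl : Prog → Ctrl
  | assign v e => Ctrl.assign v e
  | seq P₁ P₂ => Ctrl.seq P₁.toCtrl P₂
  | choice p P₁ P₂ => Ctrl.choice p P₁ P₂
  | loop b P => Ctrl.loop b P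

/-- Program states `⟨P, η, a, θ⟩`: remaining program, current valuation, probability of the
choices made so far, and the sequence of these choices. -/
@[ext] structure State : Type where
  ctrl : Ctrl
  val : Valuation
  prob : Prob
  trace : List Dir

/-- The step relation `⊢`. In an assignment `Rat.toNNRat x` is `max x 0`. -/
inductive Step : State → State → Prop
  | assign (v : Var) (e : AExpr) (η : Valuation) (a : Prob) (θ : List Dir) :
      Step ⟨Ctrl.assign v e, η, a, θ⟩ ⟨Ctrl.halt, η.update v (Rat.toNNRat (e.eval η)), a, θ⟩
  | concat1 (c c' : Ctrl) (P₂ : Prog) (η η' : Valuation) (a a' : Prob) (θ θ' : List Dir) :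
      Step ⟨c, η, a, θ⟩ ⟨c', η', a', θ'⟩ →
      Step ⟨Ctrl.seq c P₂, η, a, θ⟩ ⟨Ctrl.seq c' P₂, η', a', θ'⟩
  | concat2 (P₂ : Prog) (η : Valuation) (a : Prob) (θ : List Dir) :
      Step ⟨Ctrl.seq Ctrl.halt P₂, η, a, θ⟩ ⟨P₂.toCtrl, η, a, θ⟩
  | prob1 (p : Prob) (P₁ P₂ : Prog) (η : Valuation) (a : Prob) (θ : List Dir) :
      Step ⟨Ctrl.choice p P₁ P₂, η, a, θ⟩ ⟨P₁.toCtrl, η, a.mul p, θ ++ [Dir.L]⟩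
  | prob2 (p : Prob) (P₁ P₂ : Prog) (η : Valuation) (a : Prob) (θ : List Dir) :
      Step ⟨Ctrl.choice p P₁ P₂, η, a, θ⟩ ⟨P₂.toCtrl, η, a.mul p.compl, θ ++ [Dir.R]⟩
  | while1 (b : BExpr) (P : Prog) (η : Valuation) (a : Prob) (θ : List Dir) :
      b.eval η = true →
      Step ⟨Ctrl.loop b P, η, a, θ⟩ ⟨Ctrl.seq P.toCtrl (Prog.loop b P), η, a, θ⟩
  | while2 (b : BExpr) (P : Prog) (η : Valuation) (a : Prob) (θ : List Dir) :
      b.eval η = false →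
      Step ⟨Ctrl.loop b P, η, a, θ⟩ ⟨Ctrl.halt, η, a, θ⟩

/-- One step from `⟨c, η, a, θ⟩`, where a probabilistic choice consumes the first letter of the
given word; returns the successor state and the rest of the word. -/
def nextAux (η : Valuation) (a : Prob) (θ : List Dir) :
    Ctrl → List Dir → Option (State × List Dir)
  | Ctrl.halt, _ => none
  | Ctrl.assign v e, w =>
      some (⟨Ctrl.halt, η.update v (Rat.toNNRat (e.eval η)), a, θ⟩, w)
  | Ctrl.seq Ctrl.halt P₂, w => some (⟨P₂.toCtrl, η, a, θ⟩, w)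
  | Ctrl.seq c P₂, w =>
      (nextAux η a θ c w).map fun r =>
        (⟨Ctrl.seq r.1.ctrl P₂, r.1.val, r.1.prob, r.1.trace⟩, r.2)
  | Ctrl.choice _ _ _, [] => none
  | Ctrl.choice p P₁ _, Dir.L :: w => some (⟨P₁.toCtrl, η, a.mul p, θ ++ [Dir.L]⟩, w)
  | Ctrl.choice p _ P₂, Dir.R :: w => some (⟨P₂.toCtrl, η, a.mul p.compl, θ ++ [Dir.R]⟩, w)
  | Ctrl.loop b P, w =>
      if b.eval η = true then some (⟨Ctrl.seq P.toCtrl (Prog.loop b P), η, a, θ⟩, w)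
      else some (⟨Ctrl.halt, η, a, θ⟩, w)

/-- One step from a state, with the probabilistic choice (if any) resolved by a word. -/
def State.next (σ : State) (w : List Dir) : Option (State × List Dir) :=
  nextAux σ.val σ.prob σ.trace σ.ctrl w

theorem State.step_of_next {σ τ : State} {w w' : List Dir} (h : σ.next w = some (τ, w')) :
    Step σ τ ∧ ∃ b : List Dir, b.length ≤ 1 ∧ τ.trace = σ.trace ++ b ∧ w = b ++ w' := by
  obtain ⟨c, η, a, θ⟩ := σ
  simp only [State.next] at h ⊢
  induction c generalizing τ w w' with
  | halt => simp [nextAux] at h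
  | assign v e =>
    simp only [nextAux, Option.some.injEq, Prod.mk.injEq] at h
    obtain ⟨rfl, rfl⟩ := h
    exact ⟨Step.assign _ _ _ _ _, [], by simp⟩
  | choice p P₁ P₂ =>
    rcases w with _ | ⟨_ | _, w⟩
    · simp [nextAux] at h
    · simp only [nextAux, Option.some.injEq, Prod.mk.injEq] at h
      obtain ⟨rfl, rfl⟩ := h
      exact ⟨Step.prob1 _ _ _ _ _ _, [Dir.L], by simp⟩
    · simp only [nextAux, Option.some.injEq, Prod.mk.injEq] at h
      obtain ⟨rfl, rfl⟩ := h
      exact ⟨Step.prob2 _ _ _ _ _ _, [Dir.R], by simp⟩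
  | loop b P =>
    by_cases hb : b.eval η = true
    · simp only [nextAux, hb, if_true, Option.some.injEq, Prod.mk.injEq] at h
      obtain ⟨rfl, rfl⟩ := h
      exact ⟨Step.while1 _ _ _ _ _ hb, [], by simp⟩
    · rw [nextAux, if_neg hb] at h
      simp only [Option.some.injEq, Prod.mk.injEq] at h
      obtain ⟨rfl, rfl⟩ := h
      exact ⟨Step.while2 _ _ _ _ _ (by simpa using hb), [], by simp⟩
  | seq c P₂ ih =>
    by_cases hc : c = Ctrl.halt
    · subst hc
      simp only [nextAux, Option.some.injEq, Prod.mk.injEq] at h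
      obtain ⟨rfl, rfl⟩ := h
      exact ⟨Step.concat2 _ _ _ _, [], by simp⟩
    · rw [nextAux.eq_4 _ _ _ _ _ _ (by simpa using hc)] at h
      rw [Option.map_eq_some_iff] at h
      obtain ⟨⟨ρ, u⟩, h₁, h₂⟩ := h
      simp only [Prod.mk.injEq] at h₂
      obtain ⟨rfl, rfl⟩ := h₂
      obtain ⟨hs, b, hb⟩ := ih h₁
      exact ⟨Step.concat1 _ _ _ _ _ _ _ _ _ hs, b, hb⟩

theorem State.next_of_step {σ τ : State} {w' : List Dir} (h : Step σ τ) :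
    ∃ b : List Dir, b.length ≤ 1 ∧ τ.trace = σ.trace ++ b ∧ σ.next (b ++ w') = some (τ, w') := by
  induction h with
  | assign v e η a θ => exact ⟨[], by simp [State.next, nextAux]⟩
  | concat1 c c' P₂ η η' a a' θ θ' hs ih =>
    obtain ⟨b, h₁, h₂, h₃⟩ := ih
    refine ⟨b, h₁, h₂, ?_⟩
    have hc : c ≠ Ctrl.halt := by rintro rfl; cases hs
    simp only [State.next] at h₃ ⊢
    rw [nextAux.eq_4 _ _ _ _ _ _ (by simpa using hc), h₃]
    rfl
  | concat2 P₂ η a θ => exact ⟨[], by simp [State.next, nextAux]⟩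
  | prob1 p P₁ P₂ η a θ => exact ⟨[Dir.L], by simp [State.next, nextAux]⟩
  | prob2 p P₁ P₂ η a θ => exact ⟨[Dir.R], by simp [State.next, nextAux]⟩
  | while1 b P η a θ hb => exact ⟨[], by simp [State.next, nextAux, hb]⟩
  | while2 b P η a θ hb => exact ⟨[], by simp [State.next, nextAux, hb]⟩

/-- `State.next` computes exactly the steps `σ ⊢ τ`: the letters `b` (at most one) that the step
appends to the record of choices are the ones taken from the word. -/
theorem State.next_eq_some_iff (σ τ : State) (w w' : List Dir) :
    σ.next w = some (τ, w') ↔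
      Step σ τ ∧ ∃ b : List Dir, b.length ≤ 1 ∧ τ.trace = σ.trace ++ b ∧ w = b ++ w' := by
  refine ⟨State.step_of_next, ?_⟩
  rintro ⟨hs, b, _, h₂, rfl⟩
  obtain ⟨b', _, h₂', h₃⟩ := State.next_of_step (w' := w') hs
  have : b = b' := List.append_cancel_left (h₂.symm.trans h₂')
  rw [this]; exact h₃

/-- The state successor function `T_k(σ, w)`, with `none` for `⊥`: the state reached from `σ` by
exactly `k` steps whose probabilistic choices are resolved by, and use up, the word `w`. -/
def T : ℕ → State → List Dir → Option State
  | 0, σ, [] => some σ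
  | 0, _, _ :: _ => none
  | k + 1, σ, w => (σ.next w).bind fun r => T k r.1 r.2

/-- `℘(σ, v) = η(v) · a` for a terminal state `σ = ⟨↓, η, a, θ⟩`, and `0` otherwise. -/
def outcome : Option State → Var → ℚ≥0
  | some ⟨Ctrl.halt, η, a, _⟩, v => η v * a.1
  | _, _ => 0

/-- The initial state `⟨P, η, 1, ε⟩`. -/
def init (P : Prog) (η : Valuation) : State := ⟨P.toCtrl, η, Prob.one, []⟩

/-- The set of words over `{L, R}` of length at most `k`. -/
def words (k : ℕ) : Finset (List Dir) := (List.finite_length_le Dir k).toFinset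

/-- The expected outcome `E_{P,η}(v) ∈ [0, ∞]`. -/
def expectedOutcome (P : Prog) (η : Valuation) (v : Var) : ℝ≥0∞ :=
  ∑' k : ℕ, ∑ w ∈ words k, ((outcome (T k (init P η) w) v : ℝ≥0) : ℝ≥0∞)

/-- The set of tuples `(P, η, v, q)` with `q < E_{P,η}(v)`. -/
def LEXP : Prog × Valuation × Var × ℚ≥0 → Prop :=
  fun x => ((x.2.2.2 : ℝ≥0) : ℝ≥0∞) < expectedOutcome x.1 x.2.1 x.2.2.1

/-! ## Effective codings of the finite objects by natural numbers -/

/-- The Calkin-Wilf enumeration of the non-negative rationals. -/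
def ratOfNat (n : ℕ) : ℚ≥0 :=
  if n = 0 then 0
  else if n % 2 = 1 then ratOfNat (n / 2) + 1
  else ratOfNat (n / 2) / (ratOfNat (n / 2) + 1)
  decreasing_by all_goals omega

theorem ratOfNat_zero : ratOfNat 0 = 0 := by rw [ratOfNat]; simp

theorem ratOfNat_odd (n : ℕ) : ratOfNat (2 * n + 1) = ratOfNat n + 1 := by
  rw [ratOfNat, if_neg (by omega), if_pos (by omega)]
  congr 2; omega

theorem ratOfNat_even (n : ℕ) : ratOfNat (2 * n) = ratOfNat n / (ratOfNat n + 1) := by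
  rcases Nat.eq_zero_or_pos n with rfl | hn
  · simp [ratOfNat_zero]
  · rw [ratOfNat, if_neg (by omega), if_neg (by omega)]
    have : 2 * n / 2 = n := by omega
    rw [this]

theorem ratOfNat_even_lt (n : ℕ) : ratOfNat (2 * n) < 1 := by
  rw [ratOfNat_even, div_lt_one (by positivity)]
  exact lt_add_one _

theorem ratOfNat_injective : Function.Injective ratOfNat := by
  intro m
  induction m using Nat.strong_induction_on with
  | _ m ih =>
    intro n h
    obtain ⟨a, rfl | rfl⟩ := Nat.even_or_odd' m <;> obtain ⟨b, rfl | rfl⟩ := Nat.even_or_odd' n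
    · rcases Nat.eq_zero_or_pos a with rfl | ha
      · rcases Nat.eq_zero_or_pos b with rfl | hb
        · rfl
        · exfalso
          have key : ∀ k, 0 < k → ratOfNat k ≠ 0 := by
            intro k
            induction k using Nat.strong_induction_on with
            | _ k ihk =>
              intro hk
              obtain ⟨c, rfl | rfl⟩ := Nat.even_or_odd' k
              · rw [ratOfNat_even]
                have := ihk c (by omega) (by omega)
                positivity
              · rw [ratOfNat_odd]; positivity
          rw [Nat.mul_zero, ratOfNat_zero] at h
          exact key _ (by omega) h.symm
      · rw [ratOfNat_even, ratOfNat_even, div_eq_div_iff (by positivity) (by positivity)] at h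
        have h' : ratOfNat a = ratOfNat b := by
          rw [mul_add, mul_add, mul_one, mul_one, mul_comm (ratOfNat b)] at h
          exact add_left_cancel h
        rw [ih a (by omega) h']
    · exfalso
      have h1 := ratOfNat_even_lt a
      rw [h, ratOfNat_odd] at h1
      exact absurd h1 (not_lt.mpr (le_add_of_nonneg_left zero_le))
    · exfalso
      have h1 := ratOfNat_even_lt b
      rw [← h, ratOfNat_odd] at h1
      exact absurd h1 (not_lt.mpr (le_add_of_nonneg_left zero_le))
    · rw [ratOfNat_odd, ratOfNat_odd] at h
      rw [ih a (by omega) (add_right_cancel h)]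

theorem exists_ratOfNat (s : ℕ) : ∀ a b : ℕ, a + b = s → 0 < b →
    ∃ n, ratOfNat n = (a : ℚ≥0) / b := by
  induction s using Nat.strong_induction_on with
  | _ s ih =>
    intro a b hs hb
    have hb' : (b : ℚ≥0) ≠ 0 := by positivity
    rcases Nat.eq_zero_or_pos a with rfl | ha
    · exact ⟨0, by simp [ratOfNat_zero]⟩
    by_cases hab : b ≤ a
    · obtain ⟨c, rfl⟩ := Nat.exists_eq_add_of_le hab
      obtain ⟨n, hn⟩ := ih (c + b) (by omega) c b rfl hb
      refine ⟨2 * n + 1, ?_⟩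
      rw [ratOfNat_odd, hn]
      push_cast
      field_simp
      ring
    · obtain ⟨c, rfl⟩ := Nat.exists_eq_add_of_le (le_of_not_ge hab)
      have hc : 0 < c := by omega
      have hc' : (c : ℚ≥0) ≠ 0 := by positivity
      obtain ⟨n, hn⟩ := ih (a + c) (by omega) a c rfl hc
      refine ⟨2 * n, ?_⟩
      rw [ratOfNat_even, hn]
      push_cast
      field_simp

theorem ratOfNat_surjective : Function.Surjective ratOfNat := by
  intro q
  obtain ⟨n, hn⟩ := exists_ratOfNat _ q.num q.den rfl q.den_pos
  exact ⟨n, by rw [hn, NNRat.num_div_den]⟩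

/-- Coding of non-negative rationals. -/
def ratEquiv : ℚ≥0 ≃ ℕ := (Equiv.ofBijective ratOfNat ⟨ratOfNat_injective, ratOfNat_surjective⟩).symm

theorem ratEquiv_zero : ratEquiv 0 = 0 := by
  rw [ratEquiv, Equiv.symm_apply_eq]
  exact ratOfNat_zero.symm

instance instPrimcodableRat : Primcodable ℚ≥0 := Primcodable.ofEquiv ℕ ratEquiv

/-- `[0, 1] ∩ ℚ` consists of `1` and of the numbers `x / (x + 1)` with `x` a non-negative
rational. -/
def probEquivOption : Prob ≃ Option ℚ≥0 where
  toFun p := if p.1 = 1 then none else some (p.1 / (1 - p.1))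
  invFun
    | none => ⟨1, le_refl 1⟩
    | some x => ⟨x / (x + 1), div_le_one_of_le₀ (le_add_of_nonneg_right zero_le_one) zero_le⟩
  left_inv := by
    rintro ⟨p, hp⟩
    by_cases h : p = 1
    · simp [h]
    · have hlt : p < 1 := lt_of_le_of_ne hp h
      obtain ⟨r, hr⟩ := exists_add_of_le hp
      have hr0 : r ≠ 0 := by rintro rfl; simp at hr; exact h hr.symm
      have h1 : (1 : ℚ≥0) - p = r := by rw [hr]; simp
      simp only [h, if_false, Subtype.mk.injEq, h1]
      have : p / r + 1 = 1 / r := by field_simp; exact hr.symm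
      rw [this]
      field_simp
  right_inv := by
    rintro (_ | x)
    · simp
    · have h0 : x + 1 ≠ 0 := by positivity
      have h : x / (x + 1) ≠ 1 := by
        intro h
        rw [div_eq_one_iff_eq h0] at h
        simp at h
      have h1 : (1 : ℚ≥0) - x / (x + 1) = 1 / (x + 1) := by
        have : (1 : ℚ≥0) = x / (x + 1) + 1 / (x + 1) := by field_simp
        rw [tsub_eq_iff_eq_add_of_le (by rw [div_le_one (by positivity)]; simp)]
        rw [add_comm]; exact this
      simp only [h, if_false, h1]
      congr 1
      field_simp

/-- Coding of probabilities. -/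
def probEquiv : Prob ≃ ℕ :=
  (probEquivOption.trans (Equiv.optionCongr ratEquiv)).trans (Denumerable.eqv (Option ℕ))

instance instPrimcodableProb : Primcodable Prob := Primcodable.ofEquiv ℕ probEquiv

/-- Coding of valuations: the value at each variable is replaced by its code, and a finitely
supported function `ℕ → ℕ` is a multiset of natural numbers. -/
def valuationEquiv : Valuation ≃ ℕ :=
  ((Finsupp.mapRange.equiv ratEquiv ratEquiv_zero).trans
    (Multiset.toFinsupp (α := ℕ)).symm.toEquiv).trans (Denumerable.eqv (Multiset ℕ))

instance instPrimcodableValuation : Primcodable Valuation := Primcodable.ofEquiv ℕ valuationEquiv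

theorem unpair_lt {n m : ℕ} (h : m < n) : m.unpair.1 < n ∧ m.unpair.2 < n :=
  ⟨(Nat.unpair_left_le m).trans_lt h, (Nat.unpair_right_le m).trans_lt h⟩

/-- Code of an arithmetical expression. -/
def AExpr.toNat : AExpr → ℕ
  | const c => 5 * ratEquiv c
  | var v => 5 * v + 1
  | add e₁ e₂ => 5 * Nat.pair e₁.toNat e₂.toNat + 2
  | sub e₁ e₂ => 5 * Nat.pair e₁.toNat e₂.toNat + 3
  | mul e₁ e₂ => 5 * Nat.pair e₁.toNat e₂.toNat + 4

/-- The arithmetical expression with a given code. -/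
def AExpr.ofNat (n : ℕ) : AExpr :=
  if n % 5 = 0 then const (ratEquiv.symm (n / 5))
  else if n % 5 = 1 then var (n / 5)
  else if n % 5 = 2 then add (ofNat (n / 5).unpair.1) (ofNat (n / 5).unpair.2)
  else if n % 5 = 3 then sub (ofNat (n / 5).unpair.1) (ofNat (n / 5).unpair.2)
  else mul (ofNat (n / 5).unpair.1) (ofNat (n / 5).unpair.2)
  decreasing_by
    all_goals
      have h := unpair_lt (n := n) (m := n / 5) (by omega)
      first | exact h.1 | exact h.2

theorem mul_add_mod_div {k a r : ℕ} (h : r < k) :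
    (k * a + r) % k = r ∧ (k * a + r) / k = a := by
  have hk : 0 < k := by omega
  refine ⟨by rw [Nat.mul_add_mod, Nat.mod_eq_of_lt h], ?_⟩
  rw [Nat.mul_add_div hk, Nat.div_eq_of_lt h, Nat.add_zero]

theorem AExpr.ofNat_toNat (e : AExpr) : AExpr.ofNat e.toNat = e := by
  induction e with
  | const c =>
    have h := mul_add_mod_div (k := 5) (a := ratEquiv c) (r := 0) (by omega)
    rw [Nat.add_zero] at h
    rw [AExpr.ofNat, AExpr.toNat]; simp [h]
  | var v =>
    have h := mul_add_mod_div (k := 5) (a := v) (r := 1) (by omega)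
    rw [AExpr.ofNat, AExpr.toNat]; simp [h]
  | add e₁ e₂ h₁ h₂ =>
    have h := mul_add_mod_div (k := 5) (a := Nat.pair e₁.toNat e₂.toNat) (r := 2) (by omega)
    rw [AExpr.ofNat, AExpr.toNat]; simp [h, h₁, h₂]
  | sub e₁ e₂ h₁ h₂ =>
    have h := mul_add_mod_div (k := 5) (a := Nat.pair e₁.toNat e₂.toNat) (r := 3) (by omega)
    rw [AExpr.ofNat, AExpr.toNat]; simp [h, h₁, h₂]
  | mul e₁ e₂ h₁ h₂ =>
    have h := mul_add_mod_div (k := 5) (a := Nat.pair e₁.toNat e₂.toNat) (r := 4) (by omega)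
    rw [AExpr.ofNat, AExpr.toNat]; simp [h, h₁, h₂]

theorem AExpr.toNat_ofNat (n : ℕ) : (AExpr.ofNat n).toNat = n := by
  induction n using Nat.strong_induction_on with
  | _ n ih =>
    rw [AExpr.ofNat]
    split_ifs with h0 h1 h2 h3
    · simp only [AExpr.toNat, Equiv.apply_symm_apply]; omega
    · simp only [AExpr.toNat]; omega
    all_goals
      have h := unpair_lt (n := n) (m := n / 5) (by omega)
      simp only [AExpr.toNat, ih _ h.1, ih _ h.2, Nat.pair_unpair]
      omega

/-- Coding of arithmetical expressions. -/
def aexprEquiv : AExpr ≃ ℕ := ⟨AExpr.toNat, AExpr.ofNat, AExpr.ofNat_toNat, AExpr.toNat_ofNat⟩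

instance instPrimcodableAExpr : Primcodable AExpr := Primcodable.ofEquiv ℕ aexprEquiv

/-- Code of a Boolean expression. -/
def BExpr.toNat : BExpr → ℕ
  | eq e₁ e₂ => 5 * Nat.pair e₁.toNat e₂.toNat
  | lt e₁ e₂ => 5 * Nat.pair e₁.toNat e₂.toNat + 1
  | not b => 5 * b.toNat + 2
  | and b₁ b₂ => 5 * Nat.pair b₁.toNat b₂.toNat + 3
  | or b₁ b₂ => 5 * Nat.pair b₁.toNat b₂.toNat + 4

/-- The Boolean expression with a given code. -/
def BExpr.ofNat (n : ℕ) : BExpr :=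
  if n % 5 = 0 then eq (AExpr.ofNat (n / 5).unpair.1) (AExpr.ofNat (n / 5).unpair.2)
  else if n % 5 = 1 then lt (AExpr.ofNat (n / 5).unpair.1) (AExpr.ofNat (n / 5).unpair.2)
  else if n % 5 = 2 then not (ofNat (n / 5))
  else if n % 5 = 3 then and (ofNat (n / 5).unpair.1) (ofNat (n / 5).unpair.2)
  else or (ofNat (n / 5).unpair.1) (ofNat (n / 5).unpair.2)
  decreasing_by
    all_goals
      have h := unpair_lt (n := n) (m := n / 5) (by omega)
      first | exact h.1 | exact h.2 | omega

theorem BExpr.ofNat_toNat (b : BExpr) : BExpr.ofNat b.toNat = b := by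
  induction b with
  | eq e₁ e₂ =>
    have h := mul_add_mod_div (k := 5) (a := Nat.pair e₁.toNat e₂.toNat) (r := 0) (by omega)
    rw [Nat.add_zero] at h
    rw [BExpr.ofNat, BExpr.toNat]; simp [h, AExpr.ofNat_toNat]
  | lt e₁ e₂ =>
    have h := mul_add_mod_div (k := 5) (a := Nat.pair e₁.toNat e₂.toNat) (r := 1) (by omega)
    rw [BExpr.ofNat, BExpr.toNat]; simp [h, AExpr.ofNat_toNat]
  | not b h₁ =>
    have h := mul_add_mod_div (k := 5) (a := b.toNat) (r := 2) (by omega)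
    rw [BExpr.ofNat, BExpr.toNat]; simp [h, h₁]
  | and b₁ b₂ h₁ h₂ =>
    have h := mul_add_mod_div (k := 5) (a := Nat.pair b₁.toNat b₂.toNat) (r := 3) (by omega)
    rw [BExpr.ofNat, BExpr.toNat]; simp [h, h₁, h₂]
  | or b₁ b₂ h₁ h₂ =>
    have h := mul_add_mod_div (k := 5) (a := Nat.pair b₁.toNat b₂.toNat) (r := 4) (by omega)
    rw [BExpr.ofNat, BExpr.toNat]; simp [h, h₁, h₂]

theorem BExpr.toNat_ofNat (n : ℕ) : (BExpr.ofNat n).toNat = n := by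
  induction n using Nat.strong_induction_on with
  | _ n ih =>
    rw [BExpr.ofNat]
    split_ifs with h0 h1 h2 h3
    · simp only [BExpr.toNat, AExpr.toNat_ofNat, Nat.pair_unpair]; omega
    · simp only [BExpr.toNat, AExpr.toNat_ofNat, Nat.pair_unpair]; omega
    · simp only [BExpr.toNat, ih (n / 5) (by omega)]; omega
    all_goals
      have h := unpair_lt (n := n) (m := n / 5) (by omega)
      simp only [BExpr.toNat, ih _ h.1, ih _ h.2, Nat.pair_unpair]
      omega

/-- Coding of Boolean expressions. -/
def bexprEquiv : BExpr ≃ ℕ := ⟨BExpr.toNat, BExpr.ofNat, BExpr.ofNat_toNat, BExpr.toNat_ofNat⟩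

instance instPrimcodableBExpr : Primcodable BExpr := Primcodable.ofEquiv ℕ bexprEquiv

/-- Code of a program. -/
def Prog.toNat : Prog → ℕ
  | assign v e => 4 * Nat.pair v e.toNat
  | seq P₁ P₂ => 4 * Nat.pair P₁.toNat P₂.toNat + 1
  | choice p P₁ P₂ => 4 * Nat.pair (probEquiv p) (Nat.pair P₁.toNat P₂.toNat) + 2
  | loop b P => 4 * Nat.pair b.toNat P.toNat + 3

/-- The program with a given code. -/
def Prog.ofNat (n : ℕ) : Prog :=
  if n % 4 = 0 then assign (n / 4).unpair.1 (AExpr.ofNat (n / 4).unpair.2)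
  else if n % 4 = 1 then seq (ofNat (n / 4).unpair.1) (ofNat (n / 4).unpair.2)
  else if n % 4 = 2 then
    choice (probEquiv.symm (n / 4).unpair.1)
      (ofNat (n / 4).unpair.2.unpair.1) (ofNat (n / 4).unpair.2.unpair.2)
  else loop (BExpr.ofNat (n / 4).unpair.1) (ofNat (n / 4).unpair.2)
  decreasing_by
    all_goals
      have h := unpair_lt (n := n) (m := n / 4) (by omega)
      have h' := unpair_lt h.2
      first | exact h.1 | exact h.2 | exact h'.1 | exact h'.2

theorem Prog.ofNat_toNat (P : Prog) : Prog.ofNat P.toNat = P := by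
  induction P with
  | assign v e =>
    have h := mul_add_mod_div (k := 4) (a := Nat.pair v e.toNat) (r := 0) (by omega)
    rw [Nat.add_zero] at h
    rw [Prog.ofNat, Prog.toNat]; simp [h, AExpr.ofNat_toNat]
  | seq P₁ P₂ h₁ h₂ =>
    have h := mul_add_mod_div (k := 4) (a := Nat.pair P₁.toNat P₂.toNat) (r := 1) (by omega)
    rw [Prog.ofNat, Prog.toNat]; simp [h, h₁, h₂]
  | choice p P₁ P₂ h₁ h₂ =>
    have h := mul_add_mod_div (k := 4)
      (a := Nat.pair (probEquiv p) (Nat.pair P₁.toNat P₂.toNat)) (r := 2) (by omega)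
    rw [Prog.ofNat, Prog.toNat]; simp [h, h₁, h₂]
  | loop b P h₁ =>
    have h := mul_add_mod_div (k := 4) (a := Nat.pair b.toNat P.toNat) (r := 3) (by omega)
    rw [Prog.ofNat, Prog.toNat]; simp [h, h₁, BExpr.ofNat_toNat]

theorem Prog.toNat_ofNat (n : ℕ) : (Prog.ofNat n).toNat = n := by
  induction n using Nat.strong_induction_on with
  | _ n ih =>
    rw [Prog.ofNat]
    split_ifs with h0 h1 h2
    · simp only [Prog.toNat, AExpr.toNat_ofNat, Nat.pair_unpair]; omega
    all_goals
      have h := unpair_lt (n := n) (m := n / 4) (by omega)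
      have h' := unpair_lt h.2
    · simp only [Prog.toNat, ih _ h.1, ih _ h.2, Nat.pair_unpair]; omega
    · simp only [Prog.toNat, ih _ h'.1, ih _ h'.2, Equiv.apply_symm_apply, Nat.pair_unpair]; omega
    · simp only [Prog.toNat, BExpr.toNat_ofNat, ih _ h.2, Nat.pair_unpair]; omega

/-- Coding of programs. -/
def progEquiv : Prog ≃ ℕ := ⟨Prog.toNat, Prog.ofNat, Prog.ofNat_toNat, Prog.toNat_ofNat⟩

instance instPrimcodableProg : Primcodable Prog := Primcodable.ofEquiv ℕ progEquiv

end PGCL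

/-! ## The arithmetical hierarchy -/

namespace ArithHierarchy

/-- `n` alternating quantifiers over natural numbers in front of `R`, the first one existential
if the flag is `true` and universal if it is `false`; the list `ys` holds the values chosen so
far, in order. -/
def alternating (R : List ℕ → Prop) : ℕ → Bool → List ℕ → Prop
  | 0, _, ys => R ys
  | n + 1, true, ys => ∃ y, alternating R n false (ys ++ [y])
  | n + 1, false, ys => ∀ y, alternating R n true (ys ++ [y])

/-- The class `Σₙ⁰`: sets of the form `{x | ∃ y₁ ∀ y₂ ⋯, R (x, y₁, …, yₙ)}`, `R` decidable. -/
def IsSigma {α : Type*} [Primcodable α] (n : ℕ) (A : α → Prop) : Prop :=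
  ∃ R : α × List ℕ → Prop, ComputablePred R ∧
    ∀ x, A x ↔ alternating (fun ys => R (x, ys)) n true []

/-- `Σₙ⁰`-hardness: every set in `Σₙ⁰` many-one reduces to `A`. -/
def IsSigmaHard {α : Type*} [Primcodable α] (n : ℕ) (A : α → Prop) : Prop :=
  ∀ (β : Type) [Primcodable β] (C : β → Prop), IsSigma n C → ManyOneReducible C A

/-- `Σₙ⁰`-completeness. -/
def IsSigmaComplete {α : Type*} [Primcodable α] (n : ℕ) (A : α → Prop) : Prop :=
  IsSigma n A ∧ IsSigmaHard n A

end ArithHierarchy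

end

namespace PGCL

open Relation

/-! ## Deterministic runs -/

/-! Membership in the class: all summands of the expected outcome are non-negative, so `E` is the
supremum of its partial sums, and `q < E` holds exactly when some partial sum exceeds `q`
(`LEXP_iff`). Each partial sum is a finite sum of rationals found by running the program for a
bounded number of steps on finitely many words, so comparing it with `q` is decidable. The strict
inequality matters: it turns the supremum into an existential quantifier over `K`.

To make this decidability formal, execution is repeated on data where every operation is visibly
primitive recursive. Rationals become unreduced triples `Frac`, valuations become association lists,
and the left-nested control becomes a stack. `Config.Represents.next` shows that this machine
simulates `State.next` step by step, and `val_partialSum` carries the agreement over to the sums.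

Hardness: a `Σ₁⁰` set is the domain of a partial recursive function, hence by Kleene's normal form
it is `∃ k, g x k ≠ 0` with `g` primitive recursive (`exists_primrec_of_isSigma_one`). Programs
without probabilistic choices already compute every primitive recursive function
(`programmable_of_primrec`, by induction on its definition with fresh variables as scratch space).
The program `searchProg Q n` tries `k = 0, 1, ...` until `g n k ≠ 0`. If it stops, variable `2`
holds a nonzero value with probability one; otherwise no terminal state is ever reached. So the
expected outcome of that variable is positive exactly when the search succeeds, and `x` is sent to
the query with threshold `0`. The code of `searchProg Q n` is an explicit arithmetic function of
`n`, so this map is computable. -/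

/-- A step that does not resolve a probabilistic choice. -/
def DetStep (σ τ : State) : Prop := Step σ τ ∧ τ.trace = σ.trace

theorem DetStep.next {σ τ : State} (h : DetStep σ τ) (w : List Dir) :
    σ.next w = some (τ, w) :=
  (State.next_eq_some_iff _ _ _ _).2 ⟨h.1, [], by simp, by simp [h.2], rfl⟩

theorem DetStep.T_succ {σ τ : State} (h : DetStep σ τ) (k : ℕ) (w : List Dir) :
    T (k + 1) σ w = T k τ w := by
  simp [T, h.next]

theorem exists_T_eq_of_reflTransGen {σ τ : State} (h : ReflTransGen DetStep σ τ) :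
    ∃ k, T k σ [] = some τ := by
  induction h using ReflTransGen.head_induction_on with
  | refl => exact ⟨0, rfl⟩
  | head h _ ih =>
    obtain ⟨k, hk⟩ := ih
    exact ⟨k + 1, by rw [h.T_succ, hk]⟩

theorem T_halt_of_detStep {σ τ ρ : State} (h : DetStep σ τ) {k : ℕ} {w : List Dir}
    (hk : T k σ w = some ρ) (hρ : ρ.ctrl = Ctrl.halt) : ∃ k' < k, T k' τ w = some ρ := by
  rcases k with _ | k
  · rcases w with _ | ⟨_, _⟩
    · simp only [T, Option.some.injEq] at hk
      subst hk
      obtain ⟨hs, _⟩ := h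
      cases hs <;> simp at hρ
    · simp [T] at hk
  · exact ⟨k, Nat.lt_succ_self k, by rwa [h.T_succ] at hk⟩

/-- Terminal states have no successor and the steps here are forced, so a halting run must pass
through `τ`. The strict decrease of the step count is what later rules out halting in an endless
loop, by well-founded induction. -/
theorem T_halt_of_transGen {σ τ ρ : State} (h : TransGen DetStep σ τ) {k : ℕ} {w : List Dir}
    (hk : T k σ w = some ρ) (hρ : ρ.ctrl = Ctrl.halt) : ∃ k' < k, T k' τ w = some ρ := by
  induction h using TransGen.head_induction_on generalizing k with
  | single h => exact T_halt_of_detStep h hk hρ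
  | head h _ ih =>
    obtain ⟨k', hk', h'⟩ := T_halt_of_detStep h hk hρ
    obtain ⟨k'', hk'', h''⟩ := ih h'
    exact ⟨k'', hk''.trans hk', h''⟩

/-- `P`, started on `η`, terminates on `η'` without making probabilistic choices. -/
def Run (P : Prog) (η η' : Valuation) : Prop :=
  ∀ a θ, ReflTransGen DetStep ⟨P.toCtrl, η, a, θ⟩ ⟨Ctrl.halt, η', a, θ⟩

theorem reflTransGen_seq {σ τ : State} (h : ReflTransGen DetStep σ τ) (Q : Prog) :
    ReflTransGen DetStep ⟨Ctrl.seq σ.ctrl Q, σ.val, σ.prob, σ.trace⟩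
      ⟨Ctrl.seq τ.ctrl Q, τ.val, τ.prob, τ.trace⟩ :=
  ReflTransGen.lift (r := DetStep) (p := DetStep) (fun σ : State => ⟨Ctrl.seq σ.ctrl Q, σ.val, σ.prob, σ.trace⟩)
    (fun _ _ h => ⟨Step.concat1 _ _ _ _ _ _ _ _ _ h.1, h.2⟩) _ _ h

theorem Run.reflTransGen_seq {P : Prog} {η η' : Valuation} (h : Run P η η') (Q : Prog)
    (a : Prob) (θ : List Dir) :
    ReflTransGen DetStep ⟨Ctrl.seq P.toCtrl Q, η, a, θ⟩ ⟨Q.toCtrl, η', a, θ⟩ :=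
  (PGCL.reflTransGen_seq (h a θ) Q).tail ⟨Step.concat2 _ _ _ _, rfl⟩

theorem run_assign (v : Var) (e : AExpr) (η : Valuation) :
    Run (Prog.assign v e) η (η.update v (Rat.toNNRat (e.eval η))) :=
  fun _ _ => ReflTransGen.single ⟨Step.assign _ _ _ _ _, rfl⟩

theorem Run.seq {P Q : Prog} {η η' η'' : Valuation} (h : Run P η η') (h' : Run Q η' η'') :
    Run (Prog.seq P Q) η η'' :=
  fun a θ => (h.reflTransGen_seq Q a θ).trans (h' a θ)

theorem Run.transGen_loop {b : BExpr} {P : Prog} {η η' : Valuation} (hb : b.eval η = true)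
    (h : Run P η η') (a : Prob) (θ : List Dir) :
    TransGen DetStep ⟨Ctrl.loop b P, η, a, θ⟩ ⟨Ctrl.loop b P, η', a, θ⟩ :=
  TransGen.head' ⟨Step.while1 _ _ _ _ _ hb, rfl⟩ (h.reflTransGen_seq (Prog.loop b P) a θ)

theorem run_loop_false {b : BExpr} (P : Prog) {η : Valuation} (hb : b.eval η = false) :
    Run (Prog.loop b P) η η :=
  fun _ _ => ReflTransGen.single ⟨Step.while2 _ _ _ _ _ hb, rfl⟩

theorem Run.loop {b : BExpr} {P : Prog} {η η' η'' : Valuation} (hb : b.eval η = true)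
    (h : Run P η η') (h' : Run (Prog.loop b P) η' η'') : Run (Prog.loop b P) η η'' :=
  fun a θ => (h.transGen_loop hb a θ).to_reflTransGen.trans (h' a θ)

/-- The total-correctness rule for a loop with exactly `n` passes, proved by going down from `n`.
The invariant is a relation because the effect of a body on scratch variables is left unspecified.
-/
theorem exists_run_loop {b : BExpr} {P : Prog} (I : ℕ → Valuation → Prop) (n : ℕ)
    (hstep : ∀ j < n, ∀ η, I j η → b.eval η = true ∧ ∃ η', Run P η η' ∧ I (j + 1) η')
    (hend : ∀ η, I n η → b.eval η = false) {j : ℕ} (hj : j ≤ n) {η : Valuation} (hη : I j η) :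
    ∃ η', Run (Prog.loop b P) η η' ∧ I n η' := by
  induction hj using Nat.decreasingInduction generalizing η with
  | self => exact ⟨η, run_loop_false P (hend η hη), hη⟩
  | of_succ j hj ih =>
    obtain ⟨hb, η', hr, hI⟩ := hstep j hj η hη
    obtain ⟨η'', hr', hI'⟩ := ih hI
    exact ⟨η'', hr.loop hb hr', hI'⟩

/-! ## Programs for primitive recursive functions -/

/-- For all input variables, every output variable, and every bound `b` for these, some program
computes `f` and leaves every other variable below `b` unchanged. -/
def Programmable {n : ℕ} (f : List.Vector ℕ n → ℕ) : Prop :=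
  ∀ (inp : Fin n → ℕ) (out b : ℕ), (∀ i, inp i < b) → out < b →
    ∃ P : Prog, ∀ (η : Valuation) (v : List.Vector ℕ n), (∀ i, η (inp i) = v.get i) →
      ∃ η', Run P η η' ∧ η' out = f v ∧ ∀ u : ℕ, u < b → u ≠ out → η' u = η u

theorem _root_.Rat.toNNRat_natCast (n : ℕ) : Rat.toNNRat (n : ℚ) = n := by
  simp

theorem Programmable.comp {m n : ℕ} {f : List.Vector ℕ n → ℕ} {g : Fin n → List.Vector ℕ m → ℕ}
    (hf : Programmable f) (hg : ∀ i, Programmable (g i)) :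
    Programmable fun v => f (List.Vector.ofFn fun i => g i v) := by
  intro inp out b hinp hout
  -- The values of `g 0, ..., g (n - 1)` go to the variables `b, ..., b + n - 1`. Each call gets the
  -- bound `b + n`, which protects both the inputs and the results already stored.
  have key : ∀ k ≤ n, ∃ P : Prog, ∀ (η : Valuation) (v : List.Vector ℕ m),
      (∀ i, η (inp i) = v.get i) → ∃ η', Run P η η' ∧
        (∀ i : Fin n, i.1 < k → η' (b + i) = g i v) ∧ ∀ u : ℕ, u < b → η' u = η u := by
    intro k
    induction k with
    | zero =>
      -- The language has no empty program; an assignment to the scratch variable `b` serves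
      -- instead.
      refine fun _ => ⟨Prog.assign b (AExpr.const 0), fun η v _ => ⟨_, run_assign _ _ _, by simp, ?_⟩⟩
      intro u hu
      simp [Function.update_of_ne hu.ne]
    | succ k ih =>
      intro hk
      obtain ⟨P, hP⟩ := ih (by omega)
      obtain ⟨Q, hQ⟩ := hg ⟨k, hk⟩ inp (b + k) (b + n)
        (fun i => (hinp i).trans_le (Nat.le_add_right _ _)) (by omega)
      refine ⟨P.seq Q, fun η v hv => ?_⟩
      obtain ⟨η₁, hr₁, h₁, h₁'⟩ := hP η v hv
      obtain ⟨η₂, hr₂, h₂, h₂'⟩ := hQ η₁ v fun i => by rw [h₁' _ (hinp i), hv]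
      refine ⟨η₂, hr₁.seq hr₂, fun i hi => ?_, fun u hu => ?_⟩
      · rcases Nat.lt_succ_iff_lt_or_eq.1 hi with h | h
        · rw [h₂' _ (by omega) (by omega), h₁ i h]
        · have : i = ⟨k, hk⟩ := Fin.ext h
          subst this
          exact h₂
      · rw [h₂' _ (by omega) (by omega), h₁' u hu]
  obtain ⟨P, hP⟩ := key n le_rfl
  obtain ⟨Q, hQ⟩ := hf (fun i => b + i) out (b + n) (fun i => by omega) (by omega)
  refine ⟨P.seq Q, fun η v hv => ?_⟩
  obtain ⟨η₁, hr₁, h₁, h₁'⟩ := hP η v hv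
  obtain ⟨η₂, hr₂, h₂, h₂'⟩ := hQ η₁ (List.Vector.ofFn fun i => g i v) fun i => by
    rw [h₁ i i.2, List.Vector.get_ofFn]
  exact ⟨η₂, hr₁.seq hr₂, h₂, fun u hu hne => by rw [h₂' u (by omega) hne, h₁' u hu]⟩

/-- The variable `b` counts passes and `b + 1` holds the current value of the recursion. The output
is written only at the end, so it may coincide with an input, even with the recursion bound `inp 0`
that the guard rereads on every pass. -/
theorem Programmable.prec {n : ℕ} {f : List.Vector ℕ n → ℕ} {g : List.Vector ℕ (n + 2) → ℕ}
    (hf : Programmable f) (hg : Programmable g) :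
    Programmable fun v : List.Vector ℕ (n + 1) =>
      v.head.rec (f v.tail) fun y IH => g (y ::ᵥ IH ::ᵥ v.tail) := by
  intro inp out b hinp hout
  obtain ⟨P, hP⟩ := hf (fun i => inp i.succ) (b + 1) (b + 2)
    (fun i => (hinp _).trans_le (Nat.le_add_right _ _)) (by omega)
  -- `b + 1` is both an input and the output of `Q`; `Programmable` permits this overlap.
  obtain ⟨Q, hQ⟩ := hg (Fin.cons b (Fin.cons (b + 1) fun i => inp i.succ)) (b + 1) (b + 2)
    (fun i => by
      refine Fin.cases ?_ (fun i => Fin.cases ?_ (fun i => ?_) i) i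
      · simp
      · simp
      · simpa using (hinp i.succ).trans_le (Nat.le_add_right _ _)) (by omega)
  refine ⟨(Prog.assign b (AExpr.const 0)).seq (P.seq
    ((Prog.loop (BExpr.lt (AExpr.var b) (AExpr.var (inp 0)))
      (Q.seq (Prog.assign b (AExpr.add (AExpr.var b) (AExpr.const 1))))).seq
      (Prog.assign out (AExpr.var (b + 1))))), fun η v hv => ?_⟩
  have hv0 : η (inp 0) = v.head := by rw [hv, List.Vector.get_zero]
  have hvt : ∀ i : Fin n, η (inp i.succ) = v.tail.get i := fun i => by
    rw [hv, List.Vector.get_tail_succ]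
  set F : ℕ → ℕ := fun j => j.rec (f v.tail) fun y IH => g (y ::ᵥ IH ::ᵥ v.tail) with hF
  let I : ℕ → Valuation → Prop := fun j ζ =>
    ζ b = j ∧ ζ (b + 1) = F j ∧ ∀ u : ℕ, u < b → ζ u = η u
  obtain ⟨η₁, hr₁, h₁, h₁'⟩ := hP (η.update b 0) v.tail fun i => by
    rw [← hvt, Finsupp.update_apply, if_neg (hinp _).ne]
  have hI₁ : I 0 η₁ := by
    refine ⟨?_, h₁, fun u hu => ?_⟩
    · rw [h₁' b (by omega) (by omega)]; simp
    · rw [h₁' u (by omega) (by omega), Finsupp.update_apply, if_neg hu.ne]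
  obtain ⟨η₂, hr₂, h₂, h₂', h₂''⟩ := exists_run_loop
    (b := BExpr.lt (AExpr.var b) (AExpr.var (inp 0)))
    (P := Q.seq (Prog.assign b (AExpr.add (AExpr.var b) (AExpr.const 1)))) I v.head
    (by
      rintro j hj ζ ⟨hb, hb1, hu⟩
      have h0 : ζ (inp 0) = v.head := by rw [hu _ (hinp 0), hv0]
      refine ⟨by simpa [BExpr.eval, AExpr.eval, hb, h0] using hj, ?_⟩
      obtain ⟨ζ₁, hr, hζ, hζ'⟩ := hQ ζ (j ::ᵥ F j ::ᵥ v.tail) fun i => by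
        refine Fin.cases ?_ (fun i => Fin.cases ?_ (fun i => ?_) i) i
        · simpa using hb
        · exact hb1
        · simp [hu _ (hinp i.succ), hvt]
      refine ⟨_, hr.seq (run_assign _ _ _), ?_, ?_, fun u hub => ?_⟩
      · have : ζ₁ b = j := by rw [hζ' b (by omega) (by omega), hb]
        rw [Finsupp.update_apply, if_pos rfl]
        simp only [AExpr.eval, this]
        exact_mod_cast Rat.toNNRat_natCast (j + 1)
      · rw [Finsupp.update_apply, if_neg (Nat.succ_ne_self b), hζ]
      · rw [Finsupp.update_apply, if_neg hub.ne, hζ' u (by omega) (by omega), hu u hub])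
    (by
      rintro ζ ⟨hb, -, hu⟩
      have h0 : ζ (inp 0) = v.head := by rw [hu _ (hinp 0), hv0]
      simp [BExpr.eval, AExpr.eval, hb, h0]) (Nat.zero_le _) hI₁
  refine ⟨_, ((run_assign b (AExpr.const 0) η).seq ((?_ : Run P _ η₁).seq
    (hr₂.seq (run_assign _ _ _)))), ?_, fun u hu hne => ?_⟩
  · simpa [AExpr.eval] using hr₁
  · simp [AExpr.eval, h₂', hF]
  · rw [Finsupp.update_apply, if_neg hne, h₂'' u hu]

theorem programmable_of_primrec {n : ℕ} {f : List.Vector ℕ n → ℕ} (hf : Nat.Primrec' f) :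
    Programmable f := by
  induction hf with
  | zero =>
    intro inp out b _ _
    refine ⟨Prog.assign out (AExpr.const 0), fun η v _ => ⟨_, run_assign _ _ _, ?_, ?_⟩⟩
    · simp [AExpr.eval]
    · intro u _ hne; rw [Finsupp.update_apply, if_neg hne]
  | succ =>
    intro inp out b _ _
    refine ⟨Prog.assign out (AExpr.add (AExpr.var (inp 0)) (AExpr.const 1)),
      fun η v hv => ⟨_, run_assign _ _ _, ?_, ?_⟩⟩
    · rw [Finsupp.update_apply, if_pos rfl]
      simp only [AExpr.eval, hv, List.Vector.get_zero]
      exact_mod_cast Rat.toNNRat_natCast (v.head + 1)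
    · intro u _ hne; rw [Finsupp.update_apply, if_neg hne]
  | get i =>
    intro inp out b _ _
    refine ⟨Prog.assign out (AExpr.var (inp i)), fun η v hv => ⟨_, run_assign _ _ _, ?_, ?_⟩⟩
    · simp [AExpr.eval, hv]
    · intro u _ hne; rw [Finsupp.update_apply, if_neg hne]
  | comp g _ _ ihf ihg => exact ihf.comp ihg
  | prec _ _ ihf ihg => exact ihf.prec ihg

/-! ## Hardness -/

theorem expectedOutcome_pos_iff {P : Prog} {η : Valuation} {v : Var} :
    0 < expectedOutcome P η v ↔
      ∃ k w, w ∈ words k ∧ outcome (T k (init P η) w) v ≠ 0 := by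
  rw [expectedOutcome, pos_iff_ne_zero, ne_eq, ENNReal.tsum_eq_zero]
  simp [Finset.sum_eq_zero_iff]

/-- Search for a number `k` with `g n k ≠ 0`, where `Q` computes the value of `g` at the variables
`0` and `1`, and writes it to the variable `2`. -/
def searchProg (Q : Prog) (n : ℕ) : Prog :=
  (Prog.assign 0 (AExpr.const n)).seq
    (Prog.loop (BExpr.eq (AExpr.var 2) (AExpr.const 0))
      (Q.seq (Prog.assign 1 (AExpr.add (AExpr.var 1) (AExpr.const 1)))))

/-- The body `Q` does not depend on `n`, which enters only through the initial assignment. This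
uniformity makes the reduction computable. -/
theorem exists_searchProg {g : ℕ → ℕ → ℕ} (hg : Primrec₂ g) :
    ∃ Q, ∀ n, 0 < expectedOutcome (searchProg Q n) 0 2 ↔ ∃ k, g n k ≠ 0 := by
  obtain ⟨Q, hQ⟩ := programmable_of_primrec (Nat.Primrec'.prim_iff₂.2 hg) ![0, 1] 2 3
    (by intro i; fin_cases i <;> simp) (by omega)
  refine ⟨Q, fun n => ?_⟩
  set b : BExpr := BExpr.eq (AExpr.var 2) (AExpr.const 0) with hb
  set B : Prog := Q.seq (Prog.assign 1 (AExpr.add (AExpr.var 1) (AExpr.const 1))) with hB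
  have body : ∀ (η : Valuation) (k : ℕ), η 0 = n → η 1 = k →
      ∃ η', Run B η η' ∧ η' 0 = n ∧ η' 1 = (k + 1 : ℕ) ∧ η' 2 = g n k := by
    intro η k h0 h1
    obtain ⟨η', hr, h, h'⟩ := hQ η (n ::ᵥ k ::ᵥ List.Vector.nil) (by
      intro i
      fin_cases i
      · simpa using h0
      · exact h1)
    refine ⟨_, hr.seq (run_assign _ _ _), ?_, ?_, ?_⟩
    · rw [Finsupp.update_apply, if_neg (by decide), h' 0 (by decide) (by decide), h0]
    · rw [Finsupp.update_apply, if_pos rfl]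
      simp only [AExpr.eval, h' 1 (by decide) (by decide), h1]
      exact_mod_cast Rat.toNNRat_natCast (k + 1)
    · rw [Finsupp.update_apply, if_neg (by decide), h]
      simp
  have hfirst : ReflTransGen DetStep (init (searchProg Q n) 0)
      ⟨Ctrl.loop b B, (0 : Valuation).update 0 (n : ℚ≥0), Prob.one, []⟩ := by
    have := (run_assign 0 (AExpr.const n) 0).reflTransGen_seq (Prog.loop b B) Prob.one []
    simpa [AExpr.eval, init, searchProg, Prog.toCtrl] using this
  rw [expectedOutcome_pos_iff]
  constructor
  · rintro ⟨k, w, -, hne⟩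
    by_contra! hall
    -- If `g n` vanishes everywhere, each pass returns to the loop head with the guard still true
    -- and strictly fewer steps left, so strong induction on `K` excludes halting.
    have hdiv : ∀ (K : ℕ) (η : Valuation) (j : ℕ) (ρ : State), η 0 = n → η 1 = j → η 2 = 0 →
        T K ⟨Ctrl.loop b B, η, Prob.one, []⟩ w = some ρ → ρ.ctrl ≠ Ctrl.halt := by
      intro K
      induction K using Nat.strong_induction_on with
      | _ K ih =>
        intro η j ρ h0 h1 h2 hT hρ
        obtain ⟨η', hr, h0', h1', h2'⟩ := body η j h0 h1
        obtain ⟨K', hK', hT'⟩ := T_halt_of_transGen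
          (hr.transGen_loop (b := b) (by simp [hb, BExpr.eval, AExpr.eval, h2]) Prob.one []) hT hρ
        exact ih K' hK' η' (j + 1) ρ h0' h1' (by rw [h2', hall]; simp) hT' hρ
    rcases hT : T k (init (searchProg Q n) 0) w with _ | ρ
    · rw [hT] at hne; exact hne rfl
    · have hρ : ρ.ctrl = Ctrl.halt := by
        rw [hT] at hne
        obtain ⟨c, η, a, θ⟩ := ρ
        cases c <;> first | rfl | exact absurd rfl hne
      rcases reflTransGen_iff_eq_or_transGen.1 hfirst with h | h
      · simp [init, searchProg, Prog.toCtrl] at h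
      · obtain ⟨K, -, hK⟩ := T_halt_of_transGen h hT hρ
        exact hdiv K _ 0 ρ (by simp) (by simp) (by simp) hK hρ
  · intro hex
    classical
    set m := Nat.find hex with hm
    -- After `j > 0` passes variable `2` holds `g n (j - 1)`, and initially it is zero. The first
    -- nonzero value `g n m` is therefore seen by the guard after `m + 1` passes.
    let I : ℕ → Valuation → Prop := fun j ζ =>
      ζ 0 = n ∧ ζ 1 = j ∧ (j ≤ m → ζ 2 = 0) ∧ (j = m + 1 → ζ 2 ≠ 0)
    obtain ⟨η', hr, -, -, -, hI⟩ := exists_run_loop (b := b) (P := B) I (m + 1)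
      (by
        rintro j hj ζ ⟨h0, h1, h2, -⟩
        refine ⟨by simp [hb, BExpr.eval, AExpr.eval, h2 (by omega)], ?_⟩
        obtain ⟨η', hr, h0', h1', h2'⟩ := body ζ j h0 h1
        refine ⟨η', hr, h0', h1', fun h => ?_, fun h => ?_⟩
        · rw [h2']
          have := Nat.find_min hex (m := j) (by omega)
          simpa using this
        · rw [h2']
          have : j = m := by omega
          rw [this]
          exact_mod_cast Nat.find_spec hex)
      (by
        rintro ζ ⟨-, -, -, h⟩
        simpa [hb, BExpr.eval, AExpr.eval] using h rfl)
      (Nat.zero_le _) (η := (0 : Valuation).update 0 (n : ℚ≥0))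
      ⟨by simp, by simp, by simp, by simp⟩
    obtain ⟨k, hk⟩ := exists_T_eq_of_reflTransGen (hfirst.trans (hr Prob.one []))
    refine ⟨k, [], by simp [words], ?_⟩
    rw [hk]
    simpa [outcome, Prob.one] using hI rfl

/-! ### Computability of the reduction and Kleene's normal form -/

/-- Adding one to a rational appends the binary digit `1` to its Calkin-Wilf code, so `n` is coded
by `n` ones. This makes the constant in `searchProg` primitive recursive in `n`. -/
theorem ratEquiv_natCast (n : ℕ) : ratEquiv n = 2 ^ n - 1 := by
  rw [ratEquiv, Equiv.symm_apply_eq]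
  show _ = ratOfNat _
  induction n with
  | zero => simp [ratOfNat_zero]
  | succ n ih =>
    have h : 2 ^ (n + 1) - 1 = 2 * (2 ^ n - 1) + 1 := by
      have := Nat.one_le_two_pow (n := n)
      rw [pow_succ]; omega
    rw [h, ratOfNat_odd, ← ih]
    push_cast
    rfl

theorem primrec_searchProg (Q : Prog) : Primrec (searchProg Q) := by
  have hpow : Primrec fun n : ℕ => 2 ^ n :=
    (Primrec₂.unpaired'.1 Nat.Primrec.pow).comp (Primrec.const 2) Primrec.id
  -- The code of `searchProg Q n` written out; only the constant in the first assignment varies with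
  -- `n`.
  refine Primrec.encode_iff.1 (Primrec.of_eq (f := fun n : ℕ =>
    4 * Nat.pair (4 * Nat.pair 0 (5 * (2 ^ n - 1))) (Prog.toNat (Prog.loop
      (BExpr.eq (AExpr.var 2) (AExpr.const 0))
      (Q.seq (Prog.assign 1 (AExpr.add (AExpr.var 1) (AExpr.const 1)))))) + 1) ?_ ?_)
  · have h1 : Primrec fun n : ℕ => 5 * (2 ^ n - 1) :=
      Primrec.nat_mul.comp (Primrec.const 5) (Primrec.nat_sub.comp hpow (Primrec.const 1))
    have h2 := Primrec.nat_mul.comp (Primrec.const 4)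
      (Primrec₂.natPair.comp (Primrec.const 0) h1)
    exact Primrec.succ.comp (Primrec.nat_mul.comp (Primrec.const 4)
      (Primrec₂.natPair.comp h2 (Primrec.const _)))
  · intro n
    show _ = Prog.toNat (searchProg Q n)
    rw [searchProg, Prog.toNat, Prog.toNat.eq_1, AExpr.toNat, ratEquiv_natCast]

theorem exists_primrec_of_isSigma_one {β : Type} [Primcodable β] {C : β → Prop}
    (hC : ArithHierarchy.IsSigma 1 C) :
    ∃ g : ℕ → ℕ → ℕ, Primrec₂ g ∧ ∀ x, C x ↔ ∃ k, g (Encodable.encode x) k ≠ 0 := by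
  obtain ⟨R, hR, hC⟩ := hC
  obtain ⟨r, hr, rfl⟩ := ComputablePred.computable_iff.1 hR
  have hp : Partrec fun x : β => Nat.rfind fun y => Part.some (r (x, [y])) := by
    refine Partrec.rfind (p := fun (x : β) y => Part.some (r (x, [y]))) ?_
    exact (hr.comp (Computable.fst.pair (Computable.list_cons.comp Computable.snd
      (Computable.const [])))).partrec
  obtain ⟨c, hc⟩ := Nat.Partrec.Code.exists_code.1 hp
  -- The decidable relation is only known to be computable, so `k` is not the witness itself but a
  -- bound for `evaln` on the search for a witness; bounded evaluation is primitive recursive.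
  refine ⟨fun n k => (Nat.Partrec.Code.evaln k c n).elim 0 fun _ => 1, ?_, fun x => ?_⟩
  · have h1 : Primrec fun p : ℕ × ℕ => Nat.Partrec.Code.evaln p.2 c p.1 :=
      Nat.Partrec.Code.primrec_evaln.comp
        ((Primrec.snd.pair (Primrec.const c)).pair Primrec.fst)
    refine (Primrec.option_casesOn h1 (Primrec.const 0) (Primrec.const 1).to₂).of_eq ?_
    rintro ⟨n, k⟩
    cases h : Nat.Partrec.Code.evaln k c n <;> simp [h]
  · have h1 : C x ↔ (Nat.Partrec.Code.eval c (Encodable.encode x)).Dom := by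
      rw [hC, hc]
      simp only [ArithHierarchy.alternating, Encodable.encodek, Part.coe_some, Part.bind_some,
        Part.map_Dom, List.nil_append]
      refine Iff.trans ?_ Nat.rfind_dom.symm
      exact exists_congr fun y => by simp [eq_comm (a := true)]
    rw [h1, Part.dom_iff_mem]
    simp only [Nat.Partrec.Code.evaln_complete]
    constructor
    · rintro ⟨y, k, hk⟩
      exact ⟨k, by rw [Option.mem_def.1 hk]; simp⟩
    · rintro ⟨k, hk⟩
      rcases h : Nat.Partrec.Code.evaln k c (Encodable.encode x) with _ | y
      · rw [h] at hk; exact absurd rfl hk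
      · exact ⟨y, k, h⟩

theorem isSigmaHard_LEXP : ArithHierarchy.IsSigmaHard 1 LEXP := by
  intro β _ C hC
  obtain ⟨g, hg, hgC⟩ := exists_primrec_of_isSigma_one hC
  obtain ⟨Q, hQ⟩ := exists_searchProg hg
  refine ⟨fun x => (searchProg Q (Encodable.encode x), 0, 2, 0), ?_, fun x => ?_⟩
  · exact (((primrec_searchProg Q).comp Primrec.encode).pair (Primrec.const _)).to_comp
  · rw [hgC, ← hQ]
    simp [LEXP]

end PGCL

/-! ## Automation for primitive recursive functions -/

attribute [fun_prop] Primrec Primrec.id Primrec.const Primrec.comp Primrec.pair Primrec.fst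
  Primrec.snd Primrec.succ Primrec.option_some Primrec.encode

namespace PrimrecRules

variable {α β γ σ : Type*} [Primcodable α] [Primcodable β] [Primcodable γ] [Primcodable σ]

@[fun_prop]
theorem fst {f : α → β × γ} (hf : Primrec f) : Primrec fun a => (f a).1 := Primrec.fst.comp hf

@[fun_prop]
theorem snd {f : α → β × γ} (hf : Primrec f) : Primrec fun a => (f a).2 := Primrec.snd.comp hf

@[fun_prop]
theorem add {f g : α → ℕ} (hf : Primrec f) (hg : Primrec g) : Primrec fun a => f a + g a :=
  Primrec.nat_add.comp hf hg

@[fun_prop]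
theorem sub {f g : α → ℕ} (hf : Primrec f) (hg : Primrec g) : Primrec fun a => f a - g a :=
  Primrec.nat_sub.comp hf hg

@[fun_prop]
theorem mul {f g : α → ℕ} (hf : Primrec f) (hg : Primrec g) : Primrec fun a => f a * g a :=
  Primrec.nat_mul.comp hf hg

@[fun_prop]
theorem mod {f g : α → ℕ} (hf : Primrec f) (hg : Primrec g) : Primrec fun a => f a % g a :=
  Primrec.nat_mod.comp hf hg

@[fun_prop]
theorem div {f g : α → ℕ} (hf : Primrec f) (hg : Primrec g) : Primrec fun a => f a / g a :=
  Primrec.nat_div.comp hf hg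

@[fun_prop]
theorem unpair {f : α → ℕ} (hf : Primrec f) : Primrec fun a => (f a).unpair :=
  Primrec.unpair.comp hf

@[fun_prop]
theorem ite_eq [DecidableEq β] {c d : α → β} {f g : α → σ} (hc : Primrec c) (hd : Primrec d)
    (hf : Primrec f) (hg : Primrec g) : Primrec fun a => if c a = d a then f a else g a :=
  Primrec.ite (Primrec.eq.comp hc hd) hf hg

@[fun_prop]
theorem decide_eq [DecidableEq β] {c d : α → β} (hc : Primrec c) (hd : Primrec d) :
    Primrec fun a => decide (c a = d a) :=
  (Primrec.eq.comp hc hd).decide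

@[fun_prop]
theorem decide_lt {c d : α → ℕ} (hc : Primrec c) (hd : Primrec d) :
    Primrec fun a => decide (c a < d a) :=
  (Primrec.nat_lt.comp hc hd).decide

@[fun_prop]
theorem not {f : α → Bool} (hf : Primrec f) : Primrec fun a => !(f a) := Primrec.not.comp hf

@[fun_prop]
theorem and {f g : α → Bool} (hf : Primrec f) (hg : Primrec g) : Primrec fun a => f a && g a :=
  Primrec.and.comp hf hg

@[fun_prop]
theorem or {f g : α → Bool} (hf : Primrec f) (hg : Primrec g) : Primrec fun a => f a || g a :=
  Primrec.or.comp hf hg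

@[fun_prop]
theorem list_cons {f : α → β} {g : α → List β} (hf : Primrec f) (hg : Primrec g) :
    Primrec fun a => f a :: g a :=
  Primrec.list_cons.comp hf hg

@[fun_prop]
theorem list_length {f : α → List β} (hf : Primrec f) : Primrec fun a => (f a).length :=
  Primrec.list_length.comp hf

@[fun_prop]
theorem list_getElem? {f : α → List β} {g : α → ℕ} (hf : Primrec f) (hg : Primrec g) :
    Primrec fun a => (f a)[g a]? :=
  Primrec.list_getElem?.comp hf hg

@[fun_prop]
theorem list_lookup [DecidableEq β] {f : α → β} {g : α → List (β × γ)} (hf : Primrec f)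
    (hg : Primrec g) : Primrec fun a => (g a).lookup (f a) :=
  Primrec.listLookup.comp hf hg

@[fun_prop]
theorem list_map {f : α → List β} {g : α → β → σ} (hf : Primrec f)
    (hg : Primrec fun p : α × β => g p.1 p.2) : Primrec fun a => (f a).map (g a) :=
  Primrec.list_map hf hg.to₂

@[fun_prop]
theorem list_flatMap {f : α → List β} {g : α → β → List σ} (hf : Primrec f)
    (hg : Primrec fun p : α × β => g p.1 p.2) : Primrec fun a => (f a).flatMap (g a) :=
  Primrec.list_flatMap hf hg.to₂

@[fun_prop]
theorem list_foldr {f : α → List β} {g : α → σ} {h : α → β → σ → σ} (hf : Primrec f)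
    (hg : Primrec g) (hh : Primrec fun p : α × β × σ => h p.1 p.2.1 p.2.2) :
    Primrec fun a => (f a).foldr (h a) (g a) :=
  Primrec.list_foldr (h := fun a p => h a p.1 p.2) hf hg hh.to₂

-- Case distinctions below are written with `casesOn` and an explicit constant motive so that rules
-- of this shape apply to them.
@[fun_prop]
theorem list_casesOn {f : α → List β} {g : α → σ} {h : α → β → List β → σ} (hf : Primrec f)
    (hg : Primrec g) (hh : Primrec fun p : α × β × List β => h p.1 p.2.1 p.2.2) :
    Primrec fun a => List.casesOn (motive := fun _ => σ) (f a) (g a) (h a) :=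
  Primrec.list_casesOn (h := fun a p => h a p.1 p.2) hf hg hh.to₂

@[fun_prop]
theorem option_casesOn {o : α → Option β} {f : α → σ} {g : α → β → σ} (ho : Primrec o)
    (hf : Primrec f) (hg : Primrec fun p : α × β => g p.1 p.2) :
    Primrec fun a => Option.casesOn (motive := fun _ => σ) (o a) (f a) (g a) :=
  Primrec.option_casesOn ho hf hg.to₂

@[fun_prop]
theorem option_bind {o : α → Option β} {g : α → β → Option σ} (ho : Primrec o)
    (hg : Primrec fun p : α × β => g p.1 p.2) : Primrec fun a => (o a).bind (g a) :=
  Primrec.option_bind ho hg.to₂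

@[fun_prop]
theorem option_map {o : α → Option β} {g : α → β → σ} (ho : Primrec o)
    (hg : Primrec fun p : α × β => g p.1 p.2) : Primrec fun a => (o a).map (g a) :=
  Primrec.option_map ho hg.to₂

@[fun_prop]
theorem option_getD {o : α → Option β} {g : α → β} (ho : Primrec o) (hg : Primrec g) :
    Primrec fun a => (o a).getD (g a) :=
  Primrec.option_getD.comp ho hg

@[fun_prop]
theorem iterate {f : α → ℕ} {g : α → β} {h : α → β → β} (hf : Primrec f) (hg : Primrec g)
    (hh : Primrec fun p : α × β => h p.1 p.2) : Primrec fun a => (h a)^[f a] (g a) :=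
  Primrec.nat_iterate hf hg hh.to₂

@[fun_prop]
theorem list_range {f : α → ℕ} (hf : Primrec f) : Primrec fun a => List.range (f a) :=
  Primrec.list_range.comp hf

end PrimrecRules

namespace PGCL

@[fun_prop]
theorem primrec_ratEquiv : Primrec ratEquiv := Primrec.of_equiv

@[fun_prop]
theorem primrec_probEquiv : Primrec probEquiv := Primrec.of_equiv

/-! ## Computable rational arithmetic -/

/-- The triple `(a, b, c)` stands for the rational number `(a - b) / (c + 1)`. -/
abbrev Frac : Type := ℕ × ℕ × ℕ

namespace Frac

/-- The rational number that a triple stands for. -/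
def val (x : Frac) : ℚ := ((x.1 : ℚ) - x.2.1) / (x.2.2 + 1)

/-- Sum of fractions. -/
def add (x y : Frac) : Frac :=
  (x.1 * (y.2.2 + 1) + y.1 * (x.2.2 + 1), x.2.1 * (y.2.2 + 1) + y.2.1 * (x.2.2 + 1),
    x.2.2 * y.2.2 + x.2.2 + y.2.2)

/-- Difference of fractions. -/
def sub (x y : Frac) : Frac := add x (y.2.1, y.1, y.2.2)

/-- Product of fractions. -/
def mul (x y : Frac) : Frac :=
  (x.1 * y.1 + x.2.1 * y.2.1, x.1 * y.2.1 + x.2.1 * y.1, x.2.2 * y.2.2 + x.2.2 + y.2.2)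

/-- Positive part of a fraction. -/
def pos (x : Frac) : Frac := (x.1 - x.2.1, 0, x.2.2)

/-- Comparison of fractions. -/
def lt (x y : Frac) : Bool :=
  decide (x.1 * (y.2.2 + 1) + y.2.1 * (x.2.2 + 1) < y.1 * (x.2.2 + 1) + x.2.1 * (y.2.2 + 1))

/-- Equality of the values of fractions. -/
def eq (x y : Frac) : Bool :=
  decide (x.1 * (y.2.2 + 1) + y.2.1 * (x.2.2 + 1) = y.1 * (x.2.2 + 1) + x.2.1 * (y.2.2 + 1))

theorem val_add (x y : Frac) : val (add x y) = val x + val y := by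
  obtain ⟨a, b, c⟩ := x
  obtain ⟨d, e, f⟩ := y
  have hc : (c : ℚ) + 1 ≠ 0 := by positivity
  have hf : (f : ℚ) + 1 ≠ 0 := by positivity
  -- The third component is the denominator minus one, so denominators never vanish; this identity
  -- recovers the product of the two denominators.
  have h : (c : ℚ) * f + c + f + 1 = (c + 1) * (f + 1) := by ring
  simp only [val, add]
  push_cast
  rw [h, div_add_div _ _ hc hf]
  congr 1
  ring

theorem val_sub (x y : Frac) : val (sub x y) = val x - val y := by
  rw [sub, val_add, sub_eq_add_neg]
  congr 1
  simp only [val]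
  ring

theorem val_mul (x y : Frac) : val (mul x y) = val x * val y := by
  obtain ⟨a, b, c⟩ := x
  obtain ⟨d, e, f⟩ := y
  have h : (c : ℚ) * f + c + f + 1 = (c + 1) * (f + 1) := by ring
  simp only [val, mul]
  push_cast
  rw [h, div_mul_div_comm]
  congr 1
  ring

/-- Truncated subtraction of numerators is exactly the positive part, the denominator being
positive. -/
theorem val_pos (x : Frac) : val (pos x) = max (val x) 0 := by
  obtain ⟨a, b, c⟩ := x
  have hc : (0 : ℚ) < (c : ℚ) + 1 := by positivity
  simp only [val, pos, Nat.cast_zero, sub_zero]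
  rcases le_total b a with h | h
  · have h' : (b : ℚ) ≤ a := by exact_mod_cast h
    rw [Nat.cast_sub h, max_eq_left (div_nonneg (sub_nonneg.2 h') hc.le)]
  · have h' : (a : ℚ) ≤ b := by exact_mod_cast h
    rw [Nat.sub_eq_zero_of_le h, max_eq_right (div_nonpos_of_nonpos_of_nonneg
      (sub_nonpos.2 h') hc.le)]
    simp

/-- Clearing the positive denominators and moving subtracted parts to the other side leaves a
comparison of natural numbers, with no reduction to lowest terms. -/
theorem lt_eq (x y : Frac) : lt x y = decide (val x < val y) := by
  obtain ⟨a, b, c⟩ := x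
  obtain ⟨d, e, f⟩ := y
  have hc : (0 : ℚ) < (c : ℚ) + 1 := by positivity
  have hf : (0 : ℚ) < (f : ℚ) + 1 := by positivity
  refine decide_eq_decide.2 ?_
  simp only [val]
  rw [div_lt_div_iff₀ hc hf, ← Nat.cast_lt (α := ℚ)]
  push_cast
  constructor <;> intro h <;> linarith

theorem eq_eq (x y : Frac) : eq x y = decide (val x = val y) := by
  obtain ⟨a, b, c⟩ := x
  obtain ⟨d, e, f⟩ := y
  have hc : (c : ℚ) + 1 ≠ 0 := by positivity
  have hf : (f : ℚ) + 1 ≠ 0 := by positivity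
  refine decide_eq_decide.2 ?_
  simp only [val]
  rw [div_eq_div_iff hc hf, ← Nat.cast_inj (R := ℚ)]
  push_cast
  constructor <;> intro h <;> linarith

section

variable {α : Type*} [Primcodable α] {f g : α → Frac}

@[fun_prop]
theorem primrec_add (hf : Primrec f) (hg : Primrec g) : Primrec fun a => add (f a) (g a) := by
  unfold add; fun_prop

@[fun_prop]
theorem primrec_sub (hf : Primrec f) (hg : Primrec g) : Primrec fun a => sub (f a) (g a) := by
  unfold sub; fun_prop

@[fun_prop]
theorem primrec_mul (hf : Primrec f) (hg : Primrec g) : Primrec fun a => mul (f a) (g a) := by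
  unfold mul; fun_prop

@[fun_prop]
theorem primrec_pos (hf : Primrec f) : Primrec fun a => pos (f a) := by
  unfold pos; fun_prop

@[fun_prop]
theorem primrec_lt (hf : Primrec f) (hg : Primrec g) : Primrec fun a => lt (f a) (g a) := by
  unfold lt; fun_prop

@[fun_prop]
theorem primrec_eq (hf : Primrec f) (hg : Primrec g) : Primrec fun a => eq (f a) (g a) := by
  unfold eq; fun_prop

end

/-- The fraction for the non-negative rational with a given code. -/
def ofCode (n : ℕ) : Frac :=
  if n = 0 then (0, 0, 0)
  else if n % 2 = 1 then ((ofCode (n / 2)).1 + (ofCode (n / 2)).2.2 + 1, 0, (ofCode (n / 2)).2.2)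
  else ((ofCode (n / 2)).1, 0, (ofCode (n / 2)).1 + (ofCode (n / 2)).2.2)
  decreasing_by all_goals omega

theorem _root_.div_div_div_add_one {a c : ℚ} (hc : c ≠ 0) :
    a / c / (a / c + 1) = a / (a + c) := by
  rw [div_add_one hc, div_div_div_cancel_right₀ hc]

/-- The recursion in `ofCode` ignores the subtracted part of the earlier triple, so the induction
must also carry that it is zero. For even codes, `x = a / (c + 1)` gives `x / (x + 1) = a / (a + c +
1)`. -/
theorem val_ofCode (n : ℕ) : val (ofCode n) = ratOfNat n ∧ (ofCode n).2.1 = 0 := by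
  induction n using Nat.strong_induction_on with
  | _ n ih =>
    rw [ofCode, ratOfNat]
    split_ifs with h0 h1
    · simp [val]
    all_goals
      obtain ⟨ih1, ih2⟩ := ih (n / 2) (by omega)
      refine ⟨?_, rfl⟩
      push_cast
      rw [← ih1]
      simp only [val, ih2]
      push_cast
      have h : ((ofCode (n / 2)).2.2 : ℚ) + 1 ≠ 0 := by positivity
      simp only [sub_zero]
    · field_simp
      ring
    · rw [div_div_div_add_one h, add_assoc]

@[fun_prop]
theorem primrec_ofCode : Primrec ofCode := by
  have h : Primrec₂ fun (_ : Unit) n => ofCode n := by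
    -- Course-of-values recursion: `L` lists the values at all smaller arguments, so its length is
    -- the current argument.
    refine Primrec.nat_strong_rec _ (g := fun _ L =>
      if L.length = 0 then some (0, 0, 0) else (L[L.length / 2]?).map fun x : Frac =>
        if L.length % 2 = 1 then (x.1 + x.2.2 + 1, 0, x.2.2) else (x.1, 0, x.1 + x.2.2))
      (Primrec₂.mk (by fun_prop)) fun _ n => ?_
    rw [ofCode]
    simp only [List.length_map, List.length_range]
    split_ifs with h0 h1
    · rfl
    all_goals
      have h : n / 2 < n := by omega
      simp [h]
  exact h.comp (Primrec.const ()) Primrec.id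

/-- The fraction for a non-negative rational. -/
noncomputable def ofRat (q : ℚ≥0) : Frac := ofCode (ratEquiv q)

theorem val_ofRat (q : ℚ≥0) : val (ofRat q) = q := by
  have h : ratOfNat (ratEquiv q) = q := ratEquiv.symm_apply_apply q
  exact (val_ofCode _).1.trans (by rw [h])

@[fun_prop]
theorem primrec_ofRat : Primrec ofRat := by
  unfold ofRat; fun_prop

/-- The fraction for a probability. -/
noncomputable def ofProb (p : Prob) : Frac :=
  if probEquiv p = 0 then (1, 0, 0)
  else ((ofCode (probEquiv p - 1)).1, 0,
    (ofCode (probEquiv p - 1)).1 + (ofCode (probEquiv p - 1)).2.2)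

/-- Code `0` is the probability one; code `m + 1` is `x / (x + 1)`, where `x` has code `m`. -/
theorem val_ofProb (p : Prob) : val (ofProb p) = (p.1 : ℚ) := by
  have key : ∀ o : Option ℚ≥0, val (ofProb (probEquivOption.symm o)) =
      ((probEquivOption.symm o).1 : ℚ) := by
    rintro (_ | x)
    · have h : probEquiv (probEquivOption.symm none) = 0 := by
        simp only [probEquiv, Equiv.trans_apply, Equiv.apply_symm_apply]
        rfl
      rw [ofProb, if_pos h]
      simp [val, probEquivOption]
    · have h : probEquiv (probEquivOption.symm (some x)) = ratEquiv x + 1 := by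
        simp only [probEquiv, Equiv.trans_apply, Equiv.apply_symm_apply]
        rfl
      have hx : ratOfNat (ratEquiv x) = x := ratEquiv.symm_apply_apply x
      obtain ⟨h1, h2⟩ := val_ofCode (ratEquiv x)
      rw [ofProb, h, if_neg (Nat.succ_ne_zero _), Nat.add_sub_cancel]
      rw [hx] at h1
      show _ = ((x / (x + 1) : ℚ≥0) : ℚ)
      push_cast
      rw [← h1]
      simp only [val, h2]
      push_cast
      have h : ((ofCode (ratEquiv x)).2.2 : ℚ) + 1 ≠ 0 := by positivity
      simp only [sub_zero]
      rw [div_div_div_add_one h, add_assoc]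
  simpa using key (probEquivOption p)

@[fun_prop]
theorem primrec_ofProb : Primrec ofProb := by
  unfold ofProb; fun_prop

end Frac

/-! ## Computable evaluation of expressions -/

/-- Finite tables of values of variables; variables that do not occur have value zero. -/
abbrev Env : Type := List (Var × Frac)

/-- The value of a variable. -/
def Env.get (E : Env) (v : Var) : Frac := (E.lookup v).getD (0, 0, 0)

/-- A table holds the values of a valuation. -/
def Env.Represents (E : Env) (η : Valuation) : Prop := ∀ v, Frac.val (Env.get E v) = η v

@[fun_prop]
theorem Env.primrec_get {α : Type*} [Primcodable α] {f : α → Env} {g : α → Var}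
    (hf : Primrec f) (hg : Primrec g) : Primrec fun a => Env.get (f a) (g a) := by
  unfold Env.get; fun_prop

/-- Lookup returns the first match, so a new entry shadows older ones and nothing need be deleted.
-/
theorem Env.Represents.cons {E : Env} {η : Valuation} (h : Env.Represents E η) (v : Var)
    {x : Frac} {q : ℚ≥0} (hx : Frac.val x = q) : Env.Represents ((v, x) :: E) (η.update v q) := by
  intro u
  rw [Env.get, List.lookup_cons, Finsupp.update_apply]
  by_cases huv : u = v
  · simp [huv, hx]
  · have : (u == v) = false := by simpa using huv
    have hu := h u
    rw [Env.get] at hu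
    simpa [this, huv] using hu

/-- The table of a valuation, from its code. -/
noncomputable def Env.ofValuation (η : Valuation) : Env :=
  let l := Denumerable.raise
    ((Encodable.decode (α := List ℕ) (valuationEquiv η)).getD []) 0
  l.map fun v => (v, Frac.ofCode (l.foldr (fun u c => if u = v then c + 1 else c) 0))

theorem foldr_eq_count (l : List ℕ) (v : ℕ) :
    l.foldr (fun u c => if u = v then c + 1 else c) 0 = l.count v := by
  induction l with
  | nil => rfl
  | cons u l ih =>
    rw [List.foldr_cons, ih, List.count_cons]
    by_cases h : u = v <;> simp [h]

theorem lookup_map_self {β : Type*} (l : List ℕ) (f : ℕ → β) (v : ℕ) :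
    (l.map fun u => (u, f u)).lookup v = if v ∈ l then some (f v) else none := by
  induction l with
  | nil => rfl
  | cons u l ih =>
    rw [List.map_cons, List.lookup_cons, ih]
    by_cases h : v = u
    · simp [h]
    · have : (v == u) = false := by simpa using h
      simp [this, h]

/-- A valuation is coded as the multiset in which `v` has multiplicity the code of `η v`; `raise`
recovers its elements from the stored differences. Repeated table entries agree, and an absent
variable has multiplicity zero, which is the code of the rational zero. -/
theorem Env.represents_ofValuation (η : Valuation) :
    Env.Represents (Env.ofValuation η) η := by
  intro v
  set m := valuationEquiv η with hm
  set l := Denumerable.raise (Denumerable.ofNat (List ℕ) m) 0 with hl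
  have hη : η v = ratOfNat (l.count v) := by
    have h : η = valuationEquiv.symm m := (valuationEquiv.symm_apply_apply η).symm
    rw [h]
    show ratOfNat ((Multiset.toFinsupp (Denumerable.ofNat (Multiset ℕ) m)) v) = _
    rw [Multiset.toFinsupp_apply]
    show ratOfNat (Multiset.count v
      (Multiset.map (Denumerable.ofNat ℕ) (Denumerable.raise (Denumerable.ofNat (List ℕ) m) 0))) = _
    rw [← hl, show Denumerable.ofNat ℕ = id from funext Denumerable.ofNat_nat]
    simp
  have h' : Env.ofValuation η = l.map fun v => (v, Frac.ofCode (l.count v)) := by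
    simp only [Env.ofValuation, ← hm, Denumerable.decode_eq_ofNat, Option.getD_some, ← hl,
      foldr_eq_count]
  rw [Env.get, h', lookup_map_self l fun u => Frac.ofCode (l.count u), hη]
  split_ifs with hv
  · exact (Frac.val_ofCode _).1
  · rw [List.count_eq_zero.2 hv, ratOfNat_zero]
    simp [Frac.val]

-- `raise` changes its second argument as it recurses. It becomes a left fold that carries the
-- running total and collects the output in reverse.
@[fun_prop]
theorem primrec_raise {α : Type*} [Primcodable α] {f : α → List ℕ} (hf : Primrec f) :
    Primrec fun a => Denumerable.raise (f a) 0 := by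
  have key : ∀ (l : List ℕ) (n : ℕ), Denumerable.raise l n =
      (l.foldl (fun (s : List ℕ × ℕ) m => ((m + s.2) :: s.1, m + s.2)) ([], n)).1.reverse := by
    have gen : ∀ (l : List ℕ) (n : ℕ) (s : List ℕ), s.reverse ++ Denumerable.raise l n =
        (l.foldl (fun (s : List ℕ × ℕ) m => ((m + s.2) :: s.1, m + s.2)) (s, n)).1.reverse := by
      intro l
      induction l with
      | nil => simp [Denumerable.raise]
      | cons m l ih =>
        intro n s
        rw [List.foldl_cons, ← ih, Denumerable.raise]
        simp
    intro l n
    simpa using gen l n []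
  simp only [key]
  refine Primrec.list_reverse.comp (Primrec.fst.comp (Primrec.list_foldl hf (Primrec.const ([], 0))
    (h := fun _ p => ((p.2 + p.1.2) :: p.1.1, p.2 + p.1.2)) (Primrec₂.mk (by fun_prop))))

@[fun_prop]
theorem Env.primrec_ofValuation : Primrec Env.ofValuation := by
  have h : Primrec fun η : Valuation =>
      (Encodable.decode (α := List ℕ) (valuationEquiv η)).getD [] :=
    Primrec.option_getD.comp (Primrec.decode.comp Primrec.of_equiv) (Primrec.const [])
  unfold Env.ofValuation
  fun_prop

/-- Value of an arithmetical expression, as a fraction. -/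
noncomputable def AExpr.evalFrac (E : Env) : AExpr → Frac
  | const c => Frac.ofRat c
  | var v => Env.get E v
  | add e₁ e₂ => Frac.add (e₁.evalFrac E) (e₂.evalFrac E)
  | sub e₁ e₂ => Frac.sub (e₁.evalFrac E) (e₂.evalFrac E)
  | mul e₁ e₂ => Frac.mul (e₁.evalFrac E) (e₂.evalFrac E)

theorem AExpr.val_evalFrac {E : Env} {η : Valuation} (h : Env.Represents E η) (e : AExpr) :
    Frac.val (e.evalFrac E) = e.eval η := by
  induction e with
  | const c => exact Frac.val_ofRat c
  | var v => exact h v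
  | add e₁ e₂ h₁ h₂ => rw [AExpr.evalFrac, Frac.val_add, h₁, h₂, AExpr.eval]
  | sub e₁ e₂ h₁ h₂ => rw [AExpr.evalFrac, Frac.val_sub, h₁, h₂, AExpr.eval]
  | mul e₁ e₂ h₁ h₂ => rw [AExpr.evalFrac, Frac.val_mul, h₁, h₂, AExpr.eval]

/-- Value of a Boolean expression, computed with fractions. -/
noncomputable def BExpr.evalFrac (E : Env) : BExpr → Bool
  | eq e₁ e₂ => Frac.eq (e₁.evalFrac E) (e₂.evalFrac E)
  | lt e₁ e₂ => Frac.lt (e₁.evalFrac E) (e₂.evalFrac E)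
  | not b => !(b.evalFrac E)
  | and b₁ b₂ => b₁.evalFrac E && b₂.evalFrac E
  | or b₁ b₂ => b₁.evalFrac E || b₂.evalFrac E

theorem BExpr.evalFrac_eq {E : Env} {η : Valuation} (h : Env.Represents E η) (b : BExpr) :
    b.evalFrac E = b.eval η := by
  induction b with
  | eq e₁ e₂ =>
    rw [BExpr.evalFrac, Frac.eq_eq, AExpr.val_evalFrac h, AExpr.val_evalFrac h, BExpr.eval]
  | lt e₁ e₂ =>
    rw [BExpr.evalFrac, Frac.lt_eq, AExpr.val_evalFrac h, AExpr.val_evalFrac h, BExpr.eval]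
  | not b h₁ => rw [BExpr.evalFrac, h₁, BExpr.eval]
  | and b₁ b₂ h₁ h₂ => rw [BExpr.evalFrac, h₁, h₂, BExpr.eval]
  | or b₁ b₂ h₁ h₂ => rw [BExpr.evalFrac, h₁, h₂, BExpr.eval]

/-- Course-of-values recursion on the code: subexpressions have smaller codes, so their values are
found in `L`. -/
theorem AExpr.primrec_evalFrac_ofNat :
    Primrec₂ fun (E : Env) n => (AExpr.ofNat n).evalFrac E := by
  refine Primrec.nat_strong_rec _ (g := fun E L =>
    if L.length % 5 = 0 then some (Frac.ofCode (L.length / 5))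
    else if L.length % 5 = 1 then some (Env.get E (L.length / 5))
    else (L[(L.length / 5).unpair.1]?).bind fun x : Frac =>
      (L[(L.length / 5).unpair.2]?).map fun y : Frac =>
      if L.length % 5 = 2 then Frac.add x y
      else if L.length % 5 = 3 then Frac.sub x y else Frac.mul x y)
    (Primrec₂.mk (by fun_prop)) fun E n => ?_
  rw [AExpr.ofNat]
  simp only [List.length_map, List.length_range]
  split_ifs with h0 h1 h2 h3
  · rw [AExpr.evalFrac, Frac.ofRat]
    exact congrArg (fun n => some (Frac.ofCode n)) (ratEquiv.apply_symm_apply _).symm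
  · rfl
  all_goals
    have h := unpair_lt (n := n) (m := n / 5) (by omega)
    simp [h.1, h.2, AExpr.evalFrac]

@[fun_prop]
theorem AExpr.primrec_evalFrac_ofNat_comp {α : Type*} [Primcodable α] {f : α → Env} {g : α → ℕ}
    (hf : Primrec f) (hg : Primrec g) : Primrec fun a => (AExpr.ofNat (g a)).evalFrac (f a) :=
  AExpr.primrec_evalFrac_ofNat.comp hf hg

@[fun_prop]
theorem AExpr.primrec_evalFrac {α : Type*} [Primcodable α] {f : α → Env} {g : α → AExpr}
    (hf : Primrec f) (hg : Primrec g) : Primrec fun a => (g a).evalFrac (f a) := by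
  refine (AExpr.primrec_evalFrac_ofNat.comp hf (Primrec.encode.comp hg)).of_eq fun a => ?_
  exact congrArg (AExpr.evalFrac (f a)) (AExpr.ofNat_toNat (g a))

theorem BExpr.primrec_evalFrac_ofNat :
    Primrec₂ fun (E : Env) n => (BExpr.ofNat n).evalFrac E := by
  refine Primrec.nat_strong_rec _ (g := fun E L =>
    if L.length % 5 = 0 then some (Frac.eq ((AExpr.ofNat (L.length / 5).unpair.1).evalFrac E)
      ((AExpr.ofNat (L.length / 5).unpair.2).evalFrac E))
    else if L.length % 5 = 1 then some (Frac.lt ((AExpr.ofNat (L.length / 5).unpair.1).evalFrac E)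
      ((AExpr.ofNat (L.length / 5).unpair.2).evalFrac E))
    else if L.length % 5 = 2 then (L[L.length / 5]?).map fun x : Bool => !x
    else (L[(L.length / 5).unpair.1]?).bind fun x : Bool =>
      (L[(L.length / 5).unpair.2]?).map fun y : Bool =>
      if L.length % 5 = 3 then x && y else x || y)
    (Primrec₂.mk (by fun_prop)) fun E n => ?_
  rw [BExpr.ofNat]
  simp only [List.length_map, List.length_range]
  split_ifs with h0 h1 h2 h3
  · rfl
  · rfl
  · have h : n / 5 < n := by omega
    simp [h, BExpr.evalFrac]
  all_goals
    have h := unpair_lt (n := n) (m := n / 5) (by omega)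
    simp [h.1, h.2, BExpr.evalFrac]

@[fun_prop]
theorem BExpr.primrec_evalFrac {α : Type*} [Primcodable α] {f : α → Env} {g : α → BExpr}
    (hf : Primrec f) (hg : Primrec g) : Primrec fun a => (g a).evalFrac (f a) := by
  refine (BExpr.primrec_evalFrac_ofNat.comp hf (Primrec.encode.comp hg)).of_eq fun a => ?_
  exact congrArg (BExpr.evalFrac (f a)) (BExpr.ofNat_toNat (g a))


/-! ## Computable execution of programs -/

/-- Directions are coded as truth values. -/
def dirEquiv : Dir ≃ Bool where
  toFun d := decide (d = Dir.L)
  invFun b := bif b then Dir.L else Dir.R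
  left_inv d := by cases d <;> rfl
  right_inv b := by cases b <;> rfl

instance instPrimcodableDir : Primcodable Dir := Primcodable.ofEquiv Bool dirEquiv

@[fun_prop]
theorem primrec_progEquiv : Primrec progEquiv := Primrec.of_equiv

@[fun_prop]
theorem primrec_progEquiv_symm : Primrec progEquiv.symm := Primrec.of_equiv_symm

@[fun_prop]
theorem primrec_aexprEquiv_symm : Primrec aexprEquiv.symm := Primrec.of_equiv_symm

@[fun_prop]
theorem primrec_bexprEquiv : Primrec bexprEquiv := Primrec.of_equiv

@[fun_prop]
theorem primrec_bexprEquiv_symm : Primrec bexprEquiv.symm := Primrec.of_equiv_symm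

@[fun_prop]
theorem primrec_probEquiv_symm : Primrec probEquiv.symm := Primrec.of_equiv_symm

@[fun_prop]
theorem primrec_natPair {α : Type*} [Primcodable α] {f g : α → ℕ} (hf : Primrec f)
    (hg : Primrec g) : Primrec fun a => Nat.pair (f a) (g a) :=
  Primrec₂.natPair.comp hf hg

-- The one constructor that execution has to build: unfolding a loop pushes the loop back on the
-- stack.
@[fun_prop]
theorem Prog.primrec_loop {α : Type*} [Primcodable α] {f : α → BExpr} {g : α → Prog}
    (hf : Primrec f) (hg : Primrec g) : Primrec fun a => Prog.loop (f a) (g a) := by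
  refine Primrec.of_eq (f := fun a => progEquiv.symm
    (4 * Nat.pair (bexprEquiv (f a)) (progEquiv (g a)) + 3)) (by fun_prop) fun a => ?_
  rw [Equiv.symm_apply_eq]
  rfl

-- The constructor is the residue of the code modulo `4`, and its arguments are decoded from the
-- quotient by unpairing.
@[fun_prop]
theorem Prog.primrec_casesOn {α σ : Type*} [Primcodable α] [Primcodable σ] {p : α → Prog}
    {fa : α → Var → AExpr → σ} {fs : α → Prog → Prog → σ} {fc : α → Prob → Prog → Prog → σ}
    {fl : α → BExpr → Prog → σ} (hp : Primrec p)
    (hfa : Primrec fun x : α × Var × AExpr => fa x.1 x.2.1 x.2.2)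
    (hfs : Primrec fun x : α × Prog × Prog => fs x.1 x.2.1 x.2.2)
    (hfc : Primrec fun x : α × Prob × Prog × Prog => fc x.1 x.2.1 x.2.2.1 x.2.2.2)
    (hfl : Primrec fun x : α × BExpr × Prog => fl x.1 x.2.1 x.2.2) :
    Primrec fun a => Prog.casesOn (motive := fun _ => σ) (p a) (fa a) (fs a) (fc a) (fl a) := by
  have hn : Primrec fun a => progEquiv (p a) / 4 := by fun_prop
  have ha := hfa.comp (f := fun x : α × Var × AExpr => fa x.1 x.2.1 x.2.2)
    (g := fun a => (a, (progEquiv (p a) / 4).unpair.1,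
      aexprEquiv.symm (progEquiv (p a) / 4).unpair.2)) (by fun_prop)
  have hs := hfs.comp (f := fun x : α × Prog × Prog => fs x.1 x.2.1 x.2.2)
    (g := fun a => (a, progEquiv.symm (progEquiv (p a) / 4).unpair.1,
      progEquiv.symm (progEquiv (p a) / 4).unpair.2)) (by fun_prop)
  have hc := hfc.comp (f := fun x : α × Prob × Prog × Prog => fc x.1 x.2.1 x.2.2.1 x.2.2.2)
    (g := fun a => (a, probEquiv.symm (progEquiv (p a) / 4).unpair.1,
      progEquiv.symm (progEquiv (p a) / 4).unpair.2.unpair.1,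
      progEquiv.symm (progEquiv (p a) / 4).unpair.2.unpair.2)) (by fun_prop)
  have hl := hfl.comp (f := fun x : α × BExpr × Prog => fl x.1 x.2.1 x.2.2)
    (g := fun a => (a, bexprEquiv.symm (progEquiv (p a) / 4).unpair.1,
      progEquiv.symm (progEquiv (p a) / 4).unpair.2)) (by fun_prop)
  have hmod : Primrec fun a => progEquiv (p a) % 4 := by fun_prop
  refine (PrimrecRules.ite_eq hmod (Primrec.const 0) ha
    (PrimrecRules.ite_eq hmod (Primrec.const 1) hs
      (PrimrecRules.ite_eq hmod (Primrec.const 2) hc hl))).of_eq fun a => ?_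
  have hA (e : AExpr) : aexprEquiv.symm e.toNat = e := e.ofNat_toNat
  have hB (b : BExpr) : bexprEquiv.symm b.toNat = b := b.ofNat_toNat
  have hP (P : Prog) : progEquiv.symm P.toNat = P := P.ofNat_toNat
  have hdef (P : Prog) : progEquiv P = P.toNat := rfl
  simp only [hdef]
  rcases p a with ⟨v, e⟩ | ⟨P, Q⟩ | ⟨r, P, Q⟩ | ⟨b, P⟩
  · have h := mul_add_mod_div (k := 4) (a := Nat.pair v e.toNat) (r := 0) (by omega)
    rw [Nat.add_zero] at h
    simp [Prog.toNat, h, hA]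
  · have h := mul_add_mod_div (k := 4) (a := Nat.pair P.toNat Q.toNat) (r := 1) (by omega)
    simp [Prog.toNat, h, hP]
  · have h := mul_add_mod_div (k := 4) (a := Nat.pair (probEquiv r) (Nat.pair P.toNat Q.toNat))
      (r := 2) (by omega)
    simp [Prog.toNat, h, hP]
  · have h := mul_add_mod_div (k := 4) (a := Nat.pair b.toNat P.toNat) (r := 3) (by omega)
    simp [Prog.toNat, h, hP, hB]

/-- The head of a control (`none` for `↓`) and the programs to be executed after it. -/
abbrev Stack : Type := Option Prog × List Prog

/-- What remains to be executed, as a control. -/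
def Stack.toCtrl (s : Stack) : Ctrl := s.2.foldl Ctrl.seq (s.1.elim Ctrl.halt Prog.toCtrl)

/-- Split a sequential composition at the head. -/
def Stack.split (s : Stack) : Stack :=
  Option.casesOn (motive := fun _ => Stack) s.1 s fun P =>
    Prog.casesOn (motive := fun _ => Stack) P (fun _ _ => s) (fun P Q => (some P, Q :: s.2))
      (fun _ _ _ => s) (fun _ _ => s)

/-- Split sequential compositions at the head as long as possible. -/
noncomputable def Stack.normalize (s : Stack) : Stack :=
  Stack.split^[Option.casesOn (motive := fun _ => ℕ) s.1 0 progEquiv] s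

/-- Stack, values of the variables, and probability of the choices made so far. -/
abbrev Config : Type := Stack × Env × Frac

/-- Execute one step of a program that is not a sequential composition. -/
noncomputable def headStep (l : List Prog) (E : Env) (a : Frac) (w : List Dir) (P : Prog) :
    Option (Config × List Dir) :=
  Prog.casesOn (motive := fun _ => Option (Config × List Dir)) P
    (fun v e => some (((none, l), (v, Frac.pos (e.evalFrac E)) :: E, a), w))
    (fun _ _ => none)
    (fun p P Q => List.casesOn (motive := fun _ => Option (Config × List Dir)) w none fun d w =>
      if d = Dir.L then some (((some P, l), E, Frac.mul a (Frac.ofProb p)), w)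
      else some (((some Q, l), E, Frac.mul a (Frac.sub (1, 0, 0) (Frac.ofProb p))), w))
    (fun b Q => if b.evalFrac E = true then some (((some Q, Prog.loop b Q :: l), E, a), w)
      else some (((none, l), E, a), w))

/-- Execute one step, with the probabilistic choice (if any) resolved by a word. -/
noncomputable def Config.next (r : Config × List Dir) : Option (Config × List Dir) :=
  Option.casesOn (motive := fun _ => Option (Config × List Dir)) (Stack.normalize r.1.1).1
    (List.casesOn (motive := fun _ => Option (Config × List Dir)) (Stack.normalize r.1.1).2 none
      fun Q l => some (((some Q, l), r.1.2), r.2))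
    fun P => headStep (Stack.normalize r.1.1).2 r.1.2.1 r.1.2.2 r.2 P

/-- Execute a number of steps. -/
noncomputable def Config.run (k : ℕ) (r : Config × List Dir) : Option (Config × List Dir) :=
  (fun o => o.bind Config.next)^[k] (some r)

/-- The value of a variable times the probability of the choices, for terminal configurations. -/
def Config.outcome (o : Option (Config × List Dir)) (v : Var) : Frac :=
  Option.casesOn (motive := fun _ => Frac) o (0, 0, 0) fun r =>
    Option.casesOn (motive := fun _ => Frac) r.1.1.1
      (List.casesOn (motive := fun _ => Frac) r.1.1.2
        (List.casesOn (motive := fun _ => Frac) r.2 (Frac.mul (Env.get r.1.2.1 v) r.1.2.2)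
          fun _ _ => (0, 0, 0))
        fun _ _ => (0, 0, 0))
      fun _ => (0, 0, 0)

/-- The words of length at most `k`. -/
def wordList (k : ℕ) : List (List Dir) :=
  (fun W : List (List Dir) => [] :: W.flatMap fun w => [Dir.L :: w, Dir.R :: w])^[k] [[]]

/-- The partial sums of the expected outcome. -/
noncomputable def partialSum (P : Prog) (η : Valuation) (v : Var) (K : ℕ) : Frac :=
  (List.range K).foldr (fun k s => Frac.add ((wordList k).foldr (fun w s => Frac.add
    (Config.outcome (Config.run k (((some P, []), Env.ofValuation η, (1, 0, 0)), w)) v) s)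
      (0, 0, 0)) s) (0, 0, 0)

section

variable {α : Type*} [Primcodable α]

@[fun_prop]
theorem Stack.primrec_split : Primrec Stack.split := by
  unfold Stack.split; fun_prop

@[fun_prop]
theorem Stack.primrec_normalize : Primrec Stack.normalize := by
  unfold Stack.normalize; fun_prop

theorem primrec_headStep : Primrec fun x : (List Prog × Env × Frac × List Dir) × Prog =>
    headStep x.1.1 x.1.2.1 x.1.2.2.1 x.1.2.2.2 x.2 := by
  unfold headStep; fun_prop

@[fun_prop]
theorem primrec_headStep_comp {l : α → List Prog} {E : α → Env} {a : α → Frac} {w : α → List Dir}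
    {P : α → Prog} (hl : Primrec l) (hE : Primrec E) (ha : Primrec a) (hw : Primrec w)
    (hP : Primrec P) : Primrec fun x => headStep (l x) (E x) (a x) (w x) (P x) :=
  primrec_headStep.comp (f := fun x : (List Prog × Env × Frac × List Dir) × Prog =>
    headStep x.1.1 x.1.2.1 x.1.2.2.1 x.1.2.2.2 x.2)
    (g := fun x => ((l x, E x, a x, w x), P x)) (by fun_prop)

@[fun_prop]
theorem Config.primrec_next : Primrec Config.next := by
  unfold Config.next; fun_prop

@[fun_prop]
theorem Config.primrec_run {k : α → ℕ} {r : α → Config × List Dir} (hk : Primrec k)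
    (hr : Primrec r) : Primrec fun x => Config.run (k x) (r x) := by
  unfold Config.run; fun_prop

@[fun_prop]
theorem Config.primrec_outcome {o : α → Option (Config × List Dir)} {v : α → Var}
    (ho : Primrec o) (hv : Primrec v) : Primrec fun x => Config.outcome (o x) (v x) := by
  unfold Config.outcome; fun_prop

@[fun_prop]
theorem primrec_wordList : Primrec wordList := by
  unfold wordList; fun_prop

@[fun_prop]
theorem primrec_partialSum {P : α → Prog} {η : α → Valuation} {v : α → Var} {K : α → ℕ}
    (hP : Primrec P) (hη : Primrec η) (hv : Primrec v) (hK : Primrec K) :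
    Primrec fun x => partialSum (P x) (η x) (v x) (K x) := by
  unfold partialSum; fun_prop

end

/-! ## Correctness of the execution -/

/-- A step acts on the innermost left component as long as that is not `↓`; the pending programs are
carried along. -/
theorem nextAux_foldl (η : Valuation) (a : Prob) (θ : List Dir) (w : List Dir) (l : List Prog)
    {c : Ctrl} (hc : c ≠ Ctrl.halt) :
    nextAux η a θ (l.foldl Ctrl.seq c) w = (nextAux η a θ c w).map fun r =>
      (⟨l.foldl Ctrl.seq r.1.ctrl, r.1.val, r.1.prob, r.1.trace⟩, r.2) := by
  induction l generalizing c with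
  | nil => simp
  | cons Q l ih =>
    rw [List.foldl_cons, ih (by simp), nextAux.eq_4 _ _ _ _ _ _ (by simpa using hc),
      Option.map_map]
    rfl

theorem Prog.toCtrl_ne_halt (P : Prog) : P.toCtrl ≠ Ctrl.halt := by
  cases P <;> simp [Prog.toCtrl]

theorem Stack.toCtrl_split (s : Stack) : s.split.toCtrl = s.toCtrl := by
  rcases s with ⟨_ | ⟨v, e⟩ | ⟨P, Q⟩ | ⟨r, P, Q⟩ | ⟨b, P⟩, l⟩ <;> rfl

theorem Stack.toCtrl_normalize (s : Stack) : s.normalize.toCtrl = s.toCtrl := by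
  rw [Stack.normalize]
  generalize Option.casesOn (motive := fun _ => ℕ) s.1 0 progEquiv = n
  induction n with
  | zero => rfl
  | succ n ih => rw [Function.iterate_succ_apply', Stack.toCtrl_split, ih]

/-- Each split replaces the head by its left component, whose code is strictly smaller, and a head
that is not a sequence is a fixed point. So the code of the head bounds the number of splits needed.
-/
theorem Stack.split_iterate_ne_seq (n : ℕ) (s : Stack) (P : Prog) (Q : Prog)
    (hn : Option.casesOn (motive := fun _ => ℕ) s.1 0 progEquiv ≤ n) :
    (Stack.split^[n] s).1 ≠ some (Prog.seq P Q) := by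
  induction n generalizing s with
  | zero =>
    intro h
    rw [Function.iterate_zero, id_eq] at h
    rw [h] at hn
    have : (Prog.seq P Q).toNat ≤ 0 := hn
    rw [Prog.toNat] at this
    omega
  | succ n ih =>
    rcases s with ⟨_ | ⟨v, e⟩ | ⟨P', Q'⟩ | ⟨r, P', Q'⟩ | ⟨b, P'⟩, l⟩
    case some.seq =>
      rw [Function.iterate_succ_apply]
      refine ih (some P', Q' :: l) ?_
      have h : (Prog.seq P' Q').toNat ≤ n + 1 := hn
      have h' := Nat.left_le_pair P'.toNat Q'.toNat
      rw [Prog.toNat] at h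
      show P'.toNat ≤ n
      omega
    all_goals
      rw [Function.iterate_fixed rfl]
      simp

theorem Stack.normalize_ne_seq (s : Stack) (P Q : Prog) :
    s.normalize.1 ≠ some (Prog.seq P Q) :=
  Stack.split_iterate_ne_seq _ s P Q le_rfl

/-- A configuration describes a state, up to the record of choices. -/
structure Config.Represents (c : Config) (σ : State) : Prop where
  ctrl : c.1.toCtrl = σ.ctrl
  val : Env.Represents c.2.1 σ.val
  prob : Frac.val c.2.2 = (σ.prob.1 : ℚ)

theorem Config.Represents.headStep {l : List Prog} {E : Env} {a : Frac} {w : List Dir} {P : Prog}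
    {σ : State} (h : Config.Represents ((some P, l), E, a) σ) (hP : ∀ P₁ P₂, P ≠ Prog.seq P₁ P₂) :
    Option.Rel (fun x y => Config.Represents x.1 y.1 ∧ x.2 = y.2) (headStep l E a w P)
      (σ.next w) := by
  obtain ⟨c, η, p, θ⟩ := σ
  obtain ⟨hc, hE, ha⟩ := h
  simp only [Stack.toCtrl, Option.elim_some] at hc hE ha
  subst hc
  rw [State.next, nextAux_foldl _ _ _ _ _ P.toCtrl_ne_halt]
  rcases P with ⟨v, e⟩ | ⟨P, Q⟩ | ⟨r, P, Q⟩ | ⟨b, P⟩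
  · refine Option.Rel.some ⟨⟨rfl, hE.cons v ?_, ha⟩, rfl⟩
    rw [Frac.val_pos, AExpr.val_evalFrac hE]
    rfl
  · exact absurd rfl (hP P Q)
  · rcases w with _ | ⟨_ | _, w⟩
    · exact Option.Rel.none
    · refine Option.Rel.some ⟨⟨rfl, hE, ?_⟩, rfl⟩
      show Frac.val (Frac.mul a (Frac.ofProb r)) = ((p.1 * r.1 : ℚ≥0) : ℚ)
      rw [Frac.val_mul, Frac.val_ofProb, ha, NNRat.coe_mul]
    · refine Option.Rel.some ⟨⟨rfl, hE, ?_⟩, rfl⟩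
      show Frac.val (Frac.mul a (Frac.sub (1, 0, 0) (Frac.ofProb r))) =
        ((p.1 * (1 - r.1) : ℚ≥0) : ℚ)
      rw [Frac.val_mul, Frac.val_sub, Frac.val_ofProb, ha, NNRat.coe_mul, NNRat.coe_sub r.2]
      simp [Frac.val]
  · have hb := BExpr.evalFrac_eq hE b
    by_cases hbt : b.eval η = true
    · have h1 : PGCL.headStep l E a w (Prog.loop b P) =
          some (((some P, Prog.loop b P :: l), E, a), w) := by
        simp [PGCL.headStep, hb, hbt]
      rw [h1]
      simp only [Prog.toCtrl, nextAux, hbt, if_true, Option.map_some]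
      exact Option.Rel.some ⟨⟨rfl, hE, ha⟩, rfl⟩
    · have h1 : PGCL.headStep l E a w (Prog.loop b P) = some (((none, l), E, a), w) := by
        simp [PGCL.headStep, hb, hbt]
      rw [h1]
      simp only [Prog.toCtrl, nextAux, hbt]
      exact Option.Rel.some ⟨⟨rfl, hE, ha⟩, rfl⟩

/-- Normalizing leaves the control unchanged, so it costs no step; popping the stack is the step
from `↓; Q` to `Q`. The step-for-step match, including simultaneous failure, is needed because `T`
counts steps exactly. -/
theorem Config.Represents.next {c : Config} {σ : State} (h : Config.Represents c σ)
    (w : List Dir) :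
    Option.Rel (fun x y => Config.Represents x.1 y.1 ∧ x.2 = y.2) (Config.next (c, w))
      (σ.next w) := by
  obtain ⟨s, E, a⟩ := c
  have hs := s.toCtrl_normalize
  have hne := s.normalize_ne_seq
  rw [Config.next]
  dsimp only
  revert hs hne
  generalize s.normalize = s'
  rcases s' with ⟨_ | P, l⟩
  · intro hs _
    obtain ⟨c, η, p, θ⟩ := σ
    obtain ⟨hc, hE, ha⟩ := h
    dsimp only at hc hE ha
    rw [← hs] at hc
    subst hc
    rcases l with _ | ⟨Q, l⟩
    · exact Option.Rel.none
    · rw [State.next]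
      simp only [Stack.toCtrl, Option.elim_none, List.foldl_cons]
      rw [nextAux_foldl _ _ _ _ _ (by simp)]
      exact Option.Rel.some ⟨⟨rfl, hE, ha⟩, rfl⟩
  · intro hs hne
    exact Config.Represents.headStep (σ := σ) ⟨hs.trans h.ctrl, h.val, h.prob⟩
      fun P₁ P₂ hP => hne P₁ P₂ (congrArg some hP)

theorem Stack.toCtrl_eq_halt {s : Stack} (hs : s.toCtrl = Ctrl.halt) : s = (none, []) := by
  obtain ⟨h, l⟩ := s
  rcases List.eq_nil_or_concat l with rfl | ⟨l, Q, rfl⟩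
  · rcases h with _ | P
    · rfl
    · exact absurd hs P.toCtrl_ne_halt
  · simp [Stack.toCtrl] at hs

theorem outcome_eq_zero {σ : State} (hσ : σ.ctrl ≠ Ctrl.halt) (v : Var) :
    PGCL.outcome (some σ) v = 0 := by
  obtain ⟨c, η, p, θ⟩ := σ
  cases c <;> first | exact absurd rfl hσ | rfl

theorem Config.Represents.outcome {c : Config} {σ : State} (h : Config.Represents c σ)
    (k : ℕ) (w : List Dir) (v : Var) :
    Frac.val (Config.outcome (Config.run k (c, w)) v) = PGCL.outcome (T k σ w) v := by
  have hz : Frac.val (0, 0, 0) = 0 := by simp [Frac.val]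
  induction k generalizing c σ w with
  | zero =>
    rcases w with _ | ⟨d, w⟩
    · show Frac.val (Config.outcome (some (c, [])) v) = (PGCL.outcome (some σ) v : ℚ)
      by_cases hσ : σ.ctrl = Ctrl.halt
      · obtain ⟨s, E, a⟩ := c
        obtain ⟨c, η, p, θ⟩ := σ
        obtain ⟨hc, hE, ha⟩ := h
        dsimp only at hσ hc hE ha
        subst hσ
        rw [Stack.toCtrl_eq_halt hc]
        show Frac.val (Frac.mul (Env.get E v) a) = ((η v * p.1 : ℚ≥0) : ℚ)
        rw [Frac.val_mul, hE v, ha, NNRat.coe_mul]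
      · rw [outcome_eq_zero hσ]
        have hc : c.1.toCtrl ≠ Ctrl.halt := by rw [h.ctrl]; exact hσ
        obtain ⟨⟨_ | P, _ | ⟨Q, l⟩⟩, E, a⟩ := c
        · exact absurd rfl hc
        all_goals exact hz.trans NNRat.coe_zero.symm
    -- Unused letters: `T` yields `⊥` here, and `Config.outcome` returns zero unless the remaining
    -- word is empty.
    · show Frac.val (Config.outcome (some (c, d :: w)) v) = ((0 : ℚ≥0) : ℚ)
      obtain ⟨⟨_ | P, _ | ⟨Q, l⟩⟩, E, a⟩ := c <;> exact hz.trans NNRat.coe_zero.symm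
  | succ k ih =>
    have hrun : Config.run (k + 1) (c, w) =
        (fun o => Option.bind o Config.next)^[k] (Config.next (c, w)) := by
      rw [Config.run, Function.iterate_succ_apply]
      rfl
    rw [hrun, T]
    have hn := h.next w
    revert hn
    generalize Config.next (c, w) = x
    generalize σ.next w = y
    intro hn
    rcases hn with ⟨h1, h2⟩ | _
    · rename_i x y
      have := ih h1 x.2
      rw [Option.bind_some, ← h2]
      exact this
    -- Both executions are stuck, and `none` is a fixed point of the iterated map.
    · rw [Function.iterate_fixed rfl]
      exact hz.trans NNRat.coe_zero.symm

/-! ### Partial sums of the expected outcome -/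

theorem mem_wordList {k : ℕ} {w : List Dir} : w ∈ wordList k ↔ w.length ≤ k := by
  induction k generalizing w with
  | zero => simp [wordList]
  | succ k ih =>
    rw [wordList, Function.iterate_succ_apply']
    change w ∈ [] :: (wordList k).flatMap _ ↔ _
    rcases w with _ | ⟨_ | _, w⟩ <;> simp [ih]

/-- Each word must be counted once for the list sum to equal the sum over `words k`. -/
theorem nodup_wordList (k : ℕ) : (wordList k).Nodup := by
  induction k with
  | zero => simp [wordList]
  | succ k ih =>
    rw [wordList, Function.iterate_succ_apply']
    change ([] :: (wordList k).flatMap _).Nodup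
    rw [List.nodup_cons, List.nodup_flatMap]
    refine ⟨by simp, fun w _ => by simp, ih.imp fun {w w'} hne => ?_⟩
    simp [Function.onFun, Ne.symm hne]

theorem words_eq (k : ℕ) : words k = (wordList k).toFinset := by
  ext w
  simp [words, mem_wordList]

theorem Frac.val_foldr_add {β : Type*} (l : List β) (f : β → Frac) :
    Frac.val (l.foldr (fun b s => Frac.add (f b) s) (0, 0, 0)) =
      (l.map fun b => Frac.val (f b)).sum := by
  induction l with
  | nil => simp [Frac.val]
  | cons b l ih => rw [List.foldr_cons, Frac.val_add, ih, List.map_cons, List.sum_cons]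

theorem val_partialSum (P : Prog) (η : Valuation) (v : Var) (K : ℕ) :
    Frac.val (partialSum P η v K) =
      ((∑ k ∈ Finset.range K, ∑ w ∈ words k, outcome (T k (init P η) w) v : ℚ≥0) : ℚ) := by
  have hrep : Config.Represents ((some P, []), Env.ofValuation η, (1, 0, 0)) (init P η) :=
    ⟨rfl, Env.represents_ofValuation η, by simp [init, Prob.one, Frac.val]⟩
  have hin (k : ℕ) : (((wordList k).map fun w => Frac.val (Config.outcome
      (Config.run k (((some P, []), Env.ofValuation η, (1, 0, 0)), w)) v)).sum : ℚ) =
      ∑ w ∈ words k, (outcome (T k (init P η) w) v : ℚ) := by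
    rw [words_eq, List.sum_toFinset _ (nodup_wordList k)]
    simp only [hrep.outcome]
  rw [partialSum, Frac.val_foldr_add]
  simp only [Frac.val_foldr_add, hin]
  push_cast
  rw [← List.sum_toFinset _ List.nodup_range, List.toFinset_range]

/-! ## Enumerability -/

theorem LEXP_iff (P : Prog) (η : Valuation) (v : Var) (q : ℚ≥0) :
    LEXP (P, η, v, q) ↔ ∃ K, Frac.lt (Frac.ofRat q) (partialSum P η v K) = true := by
  have hsum (K : ℕ) : ∑ k ∈ Finset.range K, ∑ w ∈ words k,
      ((outcome (T k (init P η) w) v : ℝ≥0) : ℝ≥0∞) =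
      ((∑ k ∈ Finset.range K, ∑ w ∈ words k, outcome (T k (init P η) w) v : ℚ≥0) : ℝ≥0) := by
    push_cast
    rfl
  rw [LEXP, expectedOutcome, ENNReal.tsum_eq_iSup_nat, lt_iSup_iff]
  refine exists_congr fun K => ?_
  rw [hsum, ENNReal.coe_lt_coe, NNRat.cast_lt, Frac.lt_eq, val_partialSum, Frac.val_ofRat,
    decide_eq_true_iff, NNRat.coe_lt_coe]

theorem isSigma_LEXP : ArithHierarchy.IsSigma 1 LEXP := by
  -- The only list that matters is `[K]`, from which `headI` extracts the quantified `K`.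
  refine ⟨fun x => Frac.lt (Frac.ofRat x.1.2.2.2)
    (partialSum x.1.1 x.1.2.1 x.1.2.2.1 x.2.headI) = true, ?_, fun x => ?_⟩
  · have hK : Primrec fun x : (Prog × Valuation × Var × ℚ≥0) × List ℕ => x.2.headI :=
      Primrec.list_headI.comp Primrec.snd
    have h : Primrec fun x : (Prog × Valuation × Var × ℚ≥0) × List ℕ =>
        Frac.lt (Frac.ofRat x.1.2.2.2) (partialSum x.1.1 x.1.2.1 x.1.2.2.1 x.2.headI) := by
      fun_prop
    exact ComputablePred.computable_iff.2 ⟨_, h.to_comp, rfl⟩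
  · obtain ⟨P, η, v, q⟩ := x
    rw [LEXP_iff]
    rfl

end PGCL

theorem mainTheorem5 : ArithHierarchy.IsSigmaComplete 1 PGCL.LEXP :=
  ⟨PGCL.isSigma_LEXP, PGCL.isSigmaHard_LEXP⟩
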